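/- Let $n\ge 0$ and let $\hat a_1,\dots,\hat a_n$, $\hat a_1^\dagger,\dots,\hat a_n^\dagger$ be the bosonic annihilation and creation operators on the Hilbert space $\otimes_{j=1}^n\ell_2$ with occupation-number basis $(e_k)_{k\in\mathbb{N}^n}$, i.e. $\hat a_j e_k=\sqrt{k_j}\,e_{k-\delta_j}$, $\hat a_j^\dagger e_k=\sqrt{k_j+1}\,e_{k+\delta_j}$. Put $\mathfrak a=(\hat a_1,\dots,\hat a_n,\hat a_1^\dagger,\dots,\hat a_n^\dagger)^T$ and $J=\begin{pmatrix}0&-I_n\\ I_n&0\end{pmatrix}$, and for $z\in\mathbb{C}^n$ let $\mathbf z=(z_1,\dots,z_n,\overline z_1,\dots,\overline z_n)^T$ and let $\partial/\partial\mathbf z=(\partial/\partial z_1,\dots,\partial/\partial z_n,\partial/\partial\overline z_1,\dots,\partial/\partial\overline z_n)^T$ be the vector of Wirtinger derivatives, $\partial/\partial(i\mathbf z)=\frac1i\,\partial/\partial\mathbf z$. Let $\rho$ be a density matrix (a positive operator with trace one) whose moments of order $m\ge 0$ are finite, that is, $\operatorname{tr}(\hat N^{m/2}\rho)=\sum_{k}(k_1+\dots+k_n)^{m/2}\langle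 e_k,\rho e_k\rangle<\infty$, where $\hat N=\sum_j\hat a_j^\dagger\hat a_j$. Let $$h(\mathbf z)=\operatorname{tr}\bigl(e^{i\mathbf z^T\mathfrak a}\rho\bigr)$$ be the characteristic function of $\rho$, where the trace is computed in the basis $(e_k)$ and its series converges absolutely for all $z$. Then $h$ is $m$ times continuously differentiable as a function on $\mathbb{C}^n\cong\mathbb{R}^{2n}$, and for all $g_1,\dots,g_m\in\mathbb{C}^{2n}$ the series $\langle g_1^T\mathfrak a\cdots g_m^T\mathfrak a\rangle=\operatorname{tr}(g_1^T\mathfrak a\cdots g_m^T\mathfrak a\,\rho)=\sum_k\bigl(g_1^T\mathfrak a\cdots g_m^T\mathfrak a\,\rho\, e_k\bigr)_k$ converges absolutely, where $(\cdot)_k$ denotes the $k$-th coordinate of a sequence on $\mathbb{N}^n$, and $$\langle g_1^T\mathfrak a\cdots g_m^T\mathfrak a\rangle=\left.g_m^T\Bigl(\frac{\partial}{\partial(i\mathbf z)}-\frac12J(i\mathbf z)\Bigr)\cdots g_1^T\Bigl(\frac{\partial}{\partial(i\mathbf z)}-\frac12J(i\mathbf z)\Bigr)h(\mathbf z)\right|_{\mathbf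 z=0},$$ the operator with $g_1$ being applied first and the one with $g_m$ last. -/

import Mathlib

noncomputable section

/-- The Hilbert space `⊗_{j=1}^n ℓ₂`, realised as the space of square-summable sequences indexed by
the occupation numbers `k : Fin n → ℕ`. -/
abbrev Fock (n : ℕ) : Type := lp (fun _ : Fin n → ℕ => ℂ) 2

/-- All complex sequences indexed by the occupation numbers.  Creation and annihilation operators,
and hence all their products, act on them; on `Fock n` an operator has as its domain the
square-summable sequences whose image is square-summable. -/
abbrev FockSeq (n : ℕ) : Type := (Fin n → ℕ) → ℂ

/-- The basis vector `e_k` (tensor product of basis vectors of the factors `ℓ₂`). -/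
def fockBasis {n : ℕ} (k : Fin n → ℕ) : Fock n := lp.single 2 k 1

/-- The annihilation operator `â_j`, `â_j e_k = √(k_j) e_{k - δ_j}`. -/
def annihilation {n : ℕ} (j : Fin n) : FockSeq n →ₗ[ℂ] FockSeq n where
  toFun ψ k := (Real.sqrt ((k j : ℝ) + 1) : ℂ) * ψ (k + Pi.single j 1)
  map_add' ψ φ := by funext k; simp [mul_add]
  map_smul' c ψ := by funext k; simp [mul_left_comm]

/-- The creation operator `â_j†`, `â_j† e_k = √(k_j + 1) e_{k + δ_j}`. -/
def creation {n : ℕ} (j : Fin n) : FockSeq n →ₗ[ℂ] FockSeq n where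
  toFun ψ k := (Real.sqrt (k j : ℝ) : ℂ) * ψ (k - Pi.single j 1)
  map_add' ψ φ := by funext k; simp [mul_add]
  map_smul' c ψ := by funext k; simp [mul_left_comm]

/-- The vector `𝔞 = (â_1, …, â_n, â_1†, …, â_n†)ᵀ`. -/
def ladder {n : ℕ} : Fin n ⊕ Fin n → Module.End ℂ (FockSeq n) :=
  Sum.elim annihilation creation

/-- The linear form `gᵀ 𝔞`. -/
def linForm {n : ℕ} (g : Fin n ⊕ Fin n → ℂ) : Module.End ℂ (FockSeq n) :=
  ∑ c, g c • ladder c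

/-- The vector `𝐳 = (z_1, …, z_n, z̄_1, …, z̄_n)ᵀ`. -/
def boldVec {n : ℕ} (z : Fin n → ℂ) : Fin n ⊕ Fin n → ℂ :=
  Sum.elim z (fun j => star (z j))

/-! ### The exponential `e^{i 𝐳ᵀ 𝔞}` -/

theorem lp_norm_le_of_sum_sq {n : ℕ} {u : Fock n} {C : ℝ} (hC : 0 ≤ C)
    (h : ∀ s : Finset (Fin n → ℕ), ∑ k ∈ s, ‖u k‖ ^ 2 ≤ C ^ 2) : ‖u‖ ≤ C := by
  refine lp.norm_le_of_forall_sum_le (by norm_num) hC fun s => ?_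
  simpa using h s

theorem sum_sq_le_norm_sq {n : ℕ} (u : Fock n) (s : Finset (Fin n → ℕ)) :
    ∑ k ∈ s, ‖u k‖ ^ 2 ≤ ‖u‖ ^ 2 := by
  have := lp.sum_rpow_le_norm_rpow (p := 2) (by norm_num) u s
  simpa using this

/-- `u` has at most `M` particles. -/
def FinDeg {n : ℕ} (M : ℕ) (u : FockSeq n) : Prop := ∀ k, M < ∑ j, k j → u k = 0

theorem sum_add_single {n : ℕ} (k : Fin n → ℕ) (j : Fin n) :
    ∑ i, (k + Pi.single j 1 : Fin n → ℕ) i = ∑ i, k i + 1 := by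
  simp [Finset.sum_add_distrib]

theorem sub_add_single {n : ℕ} {k : Fin n → ℕ} {j : Fin n} (h : k j ≠ 0) :
    k - Pi.single j 1 + Pi.single j 1 = k := by
  funext i
  rcases eq_or_ne i j with rfl | hi
  · simp; omega
  · simp [hi]

theorem FinDeg.apply_ladder {n M : ℕ} {u : FockSeq n} (hu : FinDeg M u) (c : Fin n ⊕ Fin n) :
    FinDeg (M + 1) (ladder c u) := by
  intro k hk
  rcases c with j | j
  · change (Real.sqrt ((k j : ℝ) + 1) : ℂ) * u (k + Pi.single j 1) = 0
    rw [hu _ (by rw [sum_add_single]; omega), mul_zero]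
  · change (Real.sqrt (k j : ℝ) : ℂ) * u (k - Pi.single j 1) = 0
    by_cases h : k j = 0
    · simp [h]
    · have := sum_add_single (k - Pi.single j 1 : Fin n → ℕ) j
      rw [sub_add_single h] at this
      rw [hu _ (by omega), mul_zero]

theorem exists_ladder {n M : ℕ} (u : Fock n) (hu : FinDeg M (u : FockSeq n))
    (c : Fin n ⊕ Fin n) : ∃ v : Fock n, (v : FockSeq n) = ladder c (u : FockSeq n) ∧
      ‖v‖ ≤ Real.sqrt (M + 1) * ‖u‖ := by
  have key : ∀ s : Finset (Fin n → ℕ),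
      ∑ k ∈ s, ‖ladder c (u : FockSeq n) k‖ ^ 2 ≤ (Real.sqrt (M + 1) * ‖u‖) ^ 2 := by
    intro s
    rw [mul_pow, Real.sq_sqrt (by positivity)]
    rcases c with j | j
    · have h1 : ∀ k ∈ s, ‖ladder (Sum.inl j) (u : FockSeq n) k‖ ^ 2
          ≤ (M + 1 : ℝ) * ‖(u : FockSeq n) (k + Pi.single j 1)‖ ^ 2 := by
        intro k _
        change ‖(Real.sqrt ((k j : ℝ) + 1) : ℂ) * (u : FockSeq n) (k + Pi.single j 1)‖ ^ 2 ≤ _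
        rw [norm_mul, mul_pow, Complex.norm_real, Real.norm_eq_abs, sq_abs,
          Real.sq_sqrt (by positivity)]
        by_cases h : M < ∑ i, (k + Pi.single j 1 : Fin n → ℕ) i
        · rw [hu _ h]; simp
        · rw [sum_add_single] at h
          have h2 : k j ≤ ∑ i, k i := Finset.single_le_sum (fun _ _ => Nat.zero_le _) (by simp)
          have h3 : (k j : ℝ) ≤ M := by exact_mod_cast (by omega : k j ≤ M)
          gcongr
      refine (Finset.sum_le_sum h1).trans ?_
      rw [← Finset.mul_sum]
      gcongr
      have h4 := sum_sq_le_norm_sq u (s.image (fun k => k + Pi.single j 1))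
      rwa [Finset.sum_image (fun _ _ _ _ h => add_right_cancel h)] at h4
    · have h1 : ∀ k ∈ s.filter (fun k => k j ≠ 0), ‖ladder (Sum.inr j) (u : FockSeq n) k‖ ^ 2
          ≤ (M + 1 : ℝ) * ‖(u : FockSeq n) (k - Pi.single j 1)‖ ^ 2 := by
        intro k hk
        have hk0 : k j ≠ 0 := (Finset.mem_filter.1 hk).2
        change ‖(Real.sqrt (k j : ℝ) : ℂ) * (u : FockSeq n) (k - Pi.single j 1)‖ ^ 2 ≤ _
        rw [norm_mul, mul_pow, Complex.norm_real, Real.norm_eq_abs, sq_abs,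
          Real.sq_sqrt (by positivity)]
        by_cases h : M < ∑ i, (k - Pi.single j 1 : Fin n → ℕ) i
        · rw [hu _ h]; simp
        · have h5 := sum_add_single (k - Pi.single j 1 : Fin n → ℕ) j
          rw [sub_add_single hk0] at h5
          have h2 : k j ≤ ∑ i, k i := Finset.single_le_sum (fun _ _ => Nat.zero_le _) (by simp)
          have h3 : (k j : ℝ) ≤ M + 1 := by exact_mod_cast (by omega : k j ≤ M + 1)
          gcongr
      have h0 : ∑ k ∈ s, ‖ladder (Sum.inr j) (u : FockSeq n) k‖ ^ 2
          = ∑ k ∈ s.filter (fun k => k j ≠ 0), ‖ladder (Sum.inr j) (u : FockSeq n) k‖ ^ 2 := by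
        symm
        apply Finset.sum_filter_of_ne
        intro k _ hk h
        apply hk
        change ‖(Real.sqrt (k j : ℝ) : ℂ) * (u : FockSeq n) (k - Pi.single j 1)‖ ^ 2 = 0
        simp [h]
      rw [h0]
      refine (Finset.sum_le_sum h1).trans ?_
      rw [← Finset.mul_sum]
      gcongr
      have h4 := sum_sq_le_norm_sq u
        ((s.filter (fun k => k j ≠ 0)).image (fun k => k - Pi.single j 1))
      rwa [Finset.sum_image] at h4
      intro a ha b hb hab
      rw [← sub_add_single (Finset.mem_filter.1 ha).2, ← sub_add_single (Finset.mem_filter.1 hb).2]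
      exact congrArg (· + Pi.single j 1) hab
  have hmem : Memℓp (E := fun _ : Fin n → ℕ => ℂ) (ladder c (u : FockSeq n)) 2 :=
    memℓp_gen' (C := (Real.sqrt (M + 1) * ‖u‖) ^ 2) fun s => by simpa using key s
  exact ⟨⟨_, hmem⟩, rfl, lp_norm_le_of_sum_sq (by positivity) key⟩

theorem inner_ladder {n : ℕ} {u v w x : Fock n} (j : Fin n)
    (hw : (w : FockSeq n) = ladder (Sum.inl j) (u : FockSeq n))
    (hx : (x : FockSeq n) = ladder (Sum.inr j) (v : FockSeq n)) :
    inner ℂ w v = inner ℂ u x := by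
  rw [lp.inner_eq_tsum, lp.inner_eq_tsum]
  have hinj : Function.Injective (fun k : Fin n → ℕ => k + Pi.single j 1) :=
    fun _ _ h => add_right_cancel h
  rw [← hinj.tsum_eq (f := fun k => inner ℂ (u k) (x k))]
  · refine tsum_congr fun k => ?_
    rw [show w k = (Real.sqrt ((k j : ℝ) + 1) : ℂ) * (u : FockSeq n) (k + Pi.single j 1) from
        congrFun hw k,
      show x (k + Pi.single j 1) = (Real.sqrt (((k + Pi.single j 1 : Fin n → ℕ) j : ℕ) : ℝ) : ℂ) *
        (v : FockSeq n) (k + Pi.single j 1 - Pi.single j 1) from congrFun hx _]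
    simp
    ring
  · intro k hk
    rw [Function.mem_support] at hk
    have h : k j ≠ 0 := by
      intro h
      apply hk
      rw [show x k = (Real.sqrt (k j : ℝ) : ℂ) * (v : FockSeq n) (k - Pi.single j 1) from
        congrFun hx k]
      simp [h]
    exact ⟨k - Pi.single j 1, sub_add_single h⟩

theorem FinDeg.apply_linForm {n M : ℕ} {u : FockSeq n} (hu : FinDeg M u) (g : Fin n ⊕ Fin n → ℂ) :
    FinDeg (M + 1) (linForm g u) := by
  intro k hk
  simp only [linForm, LinearMap.sum_apply, LinearMap.smul_apply, Finset.sum_apply,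
    Pi.smul_apply]
  exact Finset.sum_eq_zero fun c _ => by rw [hu.apply_ladder c k hk, smul_zero]

theorem exists_linForm {n M : ℕ} (g : Fin n ⊕ Fin n → ℂ) (u : Fock n)
    (hu : FinDeg M (u : FockSeq n)) :
    ∃ v : Fock n, (v : FockSeq n) = linForm g (u : FockSeq n) ∧
      ‖v‖ ≤ (∑ c, ‖g c‖) * Real.sqrt (M + 1) * ‖u‖ := by
  choose L hL hL' using exists_ladder u hu
  refine ⟨∑ c, g c • L c, ?_, ?_⟩
  · rw [lp.coeFn_sum]
    simp [linForm, LinearMap.sum_apply, hL]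
  · refine (norm_sum_le _ _).trans ?_
    rw [Finset.sum_mul, Finset.sum_mul]
    refine Finset.sum_le_sum fun c _ => ?_
    rw [norm_smul, mul_assoc]
    exact mul_le_mul_of_nonneg_left (hL' c) (norm_nonneg _)

theorem inner_linForm {n M M' : ℕ} (z : Fin n → ℂ) {u v w x : Fock n}
    (hu : FinDeg M (u : FockSeq n)) (hv : FinDeg M' (v : FockSeq n))
    (hw : (w : FockSeq n) = linForm (boldVec z) (u : FockSeq n))
    (hx : (x : FockSeq n) = linForm (boldVec z) (v : FockSeq n)) :
    inner ℂ w v = inner ℂ u x := by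
  choose L hL _ using exists_ladder u hu
  choose L' hL' _ using exists_ladder v hv
  have e1 : w = ∑ c, boldVec z c • L c := by
    apply lp.ext
    rw [lp.coeFn_sum, hw]
    simp [linForm, LinearMap.sum_apply, hL]
  have e2 : x = ∑ c, boldVec z c • L' c := by
    apply lp.ext
    rw [lp.coeFn_sum, hx]
    simp [linForm, LinearMap.sum_apply, hL']
  have h1 : ∀ j, inner ℂ (L (Sum.inl j)) v = inner ℂ u (L' (Sum.inr j)) :=
    fun j => inner_ladder j (hL _) (hL' _)
  have h2 : ∀ j, inner ℂ (L (Sum.inr j)) v = inner ℂ u (L' (Sum.inl j)) := fun j => by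
    rw [← inner_conj_symm, ← inner_ladder j (hL' _) (hL _), inner_conj_symm]
  rw [e1, e2]
  simp only [Fintype.sum_sum_type, inner_add_left, inner_add_right, sum_inner, inner_sum,
    inner_smul_left, inner_smul_right, h1, h2, boldVec, Sum.elim_inl, Sum.elim_inr]
  rw [add_comm]
  simp

theorem finDeg_single {n : ℕ} (l : Fin n → ℕ) :
    FinDeg (∑ j, l j) (Pi.single l 1 : FockSeq n) := by
  intro k hk
  rw [Pi.single_eq_of_ne]
  rintro rfl
  exact lt_irrefl _ hk

theorem finDeg_pow_linForm {n : ℕ} (g : Fin n ⊕ Fin n → ℂ) (l : Fin n → ℕ) (r : ℕ) :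
    FinDeg (∑ j, l j + r) ((linForm g ^ r) (Pi.single l 1)) := by
  induction r with
  | zero => exact finDeg_single l
  | succ r ih => rw [pow_succ']; exact ih.apply_linForm g

theorem memlp_pow_linForm {n : ℕ} (g : Fin n ⊕ Fin n → ℂ) (l : Fin n → ℕ) (r : ℕ) :
    Memℓp (E := fun _ : Fin n → ℕ => ℂ) ((linForm g ^ r) (Pi.single l 1)) 2 := by
  induction r with
  | zero => exact (fockBasis l).2
  | succ r ih =>
    obtain ⟨v, hv, _⟩ := exists_linForm g ⟨_, ih⟩ (finDeg_pow_linForm g l r)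
    rw [pow_succ']
    have := v.2
    rw [hv] at this
    exact this

/-- `(gᵀ 𝔞)^r e_l` as a vector of the Hilbert space. -/
def powVec {n : ℕ} (g : Fin n ⊕ Fin n → ℂ) (l : Fin n → ℕ) (r : ℕ) : Fock n :=
  ⟨(linForm g ^ r) (Pi.single l 1), memlp_pow_linForm g l r⟩

theorem norm_powVec_succ {n : ℕ} (g : Fin n ⊕ Fin n → ℂ) (l : Fin n → ℕ) (r : ℕ) :
    ‖powVec g l (r + 1)‖ ≤
      (∑ c, ‖g c‖) * Real.sqrt ((∑ j, l j + r : ℕ) + 1) * ‖powVec g l r‖ := by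
  obtain ⟨v, hv, hv'⟩ := exists_linForm g (powVec g l r) (finDeg_pow_linForm g l r)
  have : powVec g l (r + 1) = v := by
    apply lp.ext
    rw [hv]
    change (linForm g ^ (r + 1)) _ = _
    rw [pow_succ']
    rfl
  rw [this]
  exact hv'

/-- The `r`-th term of the exponential series of `i 𝐳ᵀ 𝔞`, applied to `e_l`. -/
def expTerm {n : ℕ} (z : Fin n → ℂ) (l : Fin n → ℕ) (r : ℕ) : Fock n :=
  (Complex.I ^ r / (r.factorial : ℂ)) • powVec (boldVec z) l r

theorem norm_expTerm {n : ℕ} (z : Fin n → ℂ) (l : Fin n → ℕ) (r : ℕ) :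
    ‖expTerm z l r‖ = ‖powVec (boldVec z) l r‖ / r.factorial := by
  simp [expTerm, norm_smul, div_eq_inv_mul]

theorem summable_norm_expTerm {n : ℕ} (z : Fin n → ℂ) (l : Fin n → ℕ) :
    Summable fun r => ‖expTerm z l r‖ := by
  set C := ∑ c, ‖boldVec z c‖
  set d := ∑ j, l j
  have hlim : Filter.Tendsto (fun r : ℕ => C * (Real.sqrt (((d + 1 : ℕ) : ℝ) + r) / (r + 1)))
      Filter.atTop (nhds 0) := by
    rw [show (0 : ℝ) = C * 0 by simp]
    refine Filter.Tendsto.const_mul _ ?_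
    have h1 : ∀ r : ℕ, Real.sqrt (((d + 1 : ℕ) : ℝ) + r) / (r + 1)
        ≤ Real.sqrt (d + 1) * (1 / Real.sqrt ((r : ℝ) + 1)) := by
      intro r
      have hr : (0 : ℝ) < (r : ℝ) + 1 := by positivity
      have h2 : Real.sqrt (((d + 1 : ℕ) : ℝ) + r) ≤ Real.sqrt (d + 1) * Real.sqrt (r + 1) := by
        rw [← Real.sqrt_mul (by positivity)]
        apply Real.sqrt_le_sqrt
        push_cast
        nlinarith [mul_nonneg (Nat.cast_nonneg (α := ℝ) d) (Nat.cast_nonneg (α := ℝ) r)]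
      rw [div_le_iff₀ hr]
      refine h2.trans (le_of_eq ?_)
      have h3 : Real.sqrt ((r : ℝ) + 1) ≠ 0 := (Real.sqrt_pos.2 hr).ne'
      field_simp
      rw [Real.sq_sqrt hr.le]
    refine squeeze_zero (fun r => by positivity) h1 ?_
    rw [show (0 : ℝ) = Real.sqrt (d + 1) * 0 by simp]
    refine Filter.Tendsto.const_mul _ ?_
    simp only [one_div]
    exact (Real.tendsto_sqrt_atTop.comp
      (Filter.tendsto_atTop_add_const_right _ 1 tendsto_natCast_atTop_atTop)).inv_tendsto_atTop
  refine summable_of_ratio_norm_eventually_le (r := 1 / 2) (by norm_num) ?_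
  filter_upwards [hlim.eventually (gt_mem_nhds (show (0 : ℝ) < 1 / 2 by norm_num))] with r hr
  rw [norm_norm, norm_norm, norm_expTerm, norm_expTerm, Nat.factorial_succ]
  have h := norm_powVec_succ (boldVec z) l r
  have hf : (0 : ℝ) < r.factorial := by positivity
  push_cast at h ⊢
  rw [div_le_iff₀ (by positivity)]
  have hr' : C * Real.sqrt (d + r + 1) ≤ 1 / 2 * (r + 1) := by
    rw [← mul_div_assoc, div_lt_iff₀ (by positivity)] at hr
    push_cast at hr
    rw [show (d : ℝ) + 1 + r = d + r + 1 by ring] at hr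
    exact hr.le
  calc _ ≤ C * Real.sqrt (d + r + 1) * ‖powVec (boldVec z) l r‖ := by
        simpa [C, d] using h
    _ ≤ 1 / 2 * (r + 1) * ‖powVec (boldVec z) l r‖ := by gcongr
    _ = _ := by field_simp

/-- `e^{i 𝐳ᵀ 𝔞} e_l`, by the (norm convergent) exponential series. -/
def expVec {n : ℕ} (z : Fin n → ℂ) (l : Fin n → ℕ) : Fock n := ∑' r, expTerm z l r

theorem inner_powVec {n : ℕ} (z : Fin n → ℂ) (k l : Fin n → ℕ) (r s : ℕ) :
    inner ℂ (powVec (boldVec z) k r) (powVec (boldVec z) l s)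
      = inner ℂ (fockBasis k) (powVec (boldVec z) l (r + s)) := by
  induction r generalizing s with
  | zero => rw [zero_add]; rfl
  | succ r ih =>
    rw [show r + 1 + s = r + (s + 1) by ring, ← ih]
    refine inner_linForm z (finDeg_pow_linForm _ k r) (finDeg_pow_linForm _ l s) ?_ ?_
    · change (linForm _ ^ (r + 1)) _ = _
      rw [pow_succ']; rfl
    · change (linForm _ ^ (s + 1)) _ = _
      rw [pow_succ']; rfl

theorem inner_expVec {n : ℕ} (z : Fin n → ℂ) (k l : Fin n → ℕ) :
    inner ℂ (expVec z k) (expVec z l) = inner ℂ (fockBasis k) (fockBasis l) := by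
  have hk := (summable_norm_expTerm z k)
  have hl := (summable_norm_expTerm z l)
  have hs : Summable fun p : ℕ × ℕ => inner ℂ (expTerm z k p.1) (expTerm z l p.2) :=
    Summable.of_norm_bounded (hk.mul_of_nonneg hl (fun _ => norm_nonneg _) fun _ => norm_nonneg _)
      fun p => norm_inner_le_norm _ _
  have h1 : inner ℂ (expVec z k) (expVec z l)
      = ∑' p : ℕ × ℕ, inner ℂ (expTerm z k p.1) (expTerm z l p.2) := by
    rw [hs.tsum_prod]
    have e1 : ∀ x : Fock n, inner ℂ x (expVec z l) = ∑' s, inner ℂ x (expTerm z l s) := fun x =>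
      (innerSL ℂ x).map_tsum hl.of_norm
    have e2 : ∀ x : Fock n, inner ℂ (expVec z k) x = ∑' r, inner ℂ (expTerm z k r) x := fun x => by
      rw [← inner_conj_symm]
      have : inner ℂ x (expVec z k) = ∑' r, inner ℂ x (expTerm z k r) :=
        (innerSL ℂ x).map_tsum hk.of_norm
      rw [this, Complex.conj_tsum]
      exact tsum_congr fun r => inner_conj_symm _ _
    rw [e2]
    exact tsum_congr fun r => e1 _
  rw [h1, ← Finset.HasAntidiagonal.sigmaAntidiagonalEquivProd.tsum_eq]
  have hs' : Summable fun c : (Σ N : ℕ, Finset.HasAntidiagonal.antidiagonal N) =>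
      inner ℂ (expTerm z k (Finset.HasAntidiagonal.sigmaAntidiagonalEquivProd c).1)
        (expTerm z l (Finset.HasAntidiagonal.sigmaAntidiagonalEquivProd c).2) :=
    (Finset.HasAntidiagonal.sigmaAntidiagonalEquivProd.summable_iff (f := fun p : ℕ × ℕ =>
      inner ℂ (expTerm z k p.1) (expTerm z l p.2))).2 hs
  rw [hs'.tsum_sigma' (fun _ => (hasSum_fintype _).summable)]
  rw [tsum_eq_single 0]
  · simp [Finset.HasAntidiagonal.sigmaAntidiagonalEquivProd, tsum_fintype, expTerm, powVec]
    rfl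
  · intro N hN
    rw [tsum_fintype]
    simp only [Finset.HasAntidiagonal.sigmaAntidiagonalEquivProd_apply]
    rw [Finset.sum_coe_sort (Finset.HasAntidiagonal.antidiagonal N)
      (fun p : ℕ × ℕ => inner ℂ (expTerm z k p.1) (expTerm z l p.2))]
    have : ∀ p ∈ Finset.HasAntidiagonal.antidiagonal N, inner ℂ (expTerm z k p.1) (expTerm z l p.2)
        = (Complex.I ^ N / N.factorial * inner ℂ (fockBasis k) (powVec (boldVec z) l N)) *
          ((N.choose p.1 : ℂ) * ((-1) ^ p.1 * 1 ^ p.2)) := by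
      rintro ⟨r, s⟩ hp
      rw [Finset.HasAntidiagonal.mem_antidiagonal] at hp
      simp only at hp
      subst hp
      rw [expTerm, expTerm, inner_smul_left, inner_smul_right, inner_powVec,
        Nat.cast_add_choose]
      have hr : (r.factorial : ℂ) ≠ 0 := by exact_mod_cast Nat.factorial_ne_zero r
      have hs : (s.factorial : ℂ) ≠ 0 := by exact_mod_cast Nat.factorial_ne_zero s
      have hrs : ((r + s).factorial : ℂ) ≠ 0 := by exact_mod_cast Nat.factorial_ne_zero _
      have hI : (starRingEnd ℂ) (Complex.I ^ r) = (-1) ^ r * Complex.I ^ r := by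
        rw [map_pow, Complex.conj_I, neg_pow]
      rw [map_div₀, hI, Complex.conj_natCast, pow_add]
      push_cast
      field_simp
      simp
    rw [Finset.sum_congr rfl this, ← Finset.mul_sum]
    have hb := (Commute.all (-1 : ℂ) 1).add_pow' N
    simp only [nsmul_eq_mul] at hb
    rw [← hb]
    simp [hN]

theorem orthonormal_expVec {n : ℕ} (z : Fin n → ℂ) : Orthonormal ℂ (expVec z) := by
  rw [orthonormal_iff_ite]
  intro k l
  rw [inner_expVec, fockBasis, fockBasis, lp.inner_single_left, lp.single_apply]
  by_cases h : k = l
  · subst h; simp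
  · simp [h]

/-- The operator `e^{i 𝐳ᵀ 𝔞}` (Weyl operator): the continuous linear extension to the whole Hilbert
space of the exponential series on the vectors `e_l`.  It is isometric because the vectors
`e^{i 𝐳ᵀ 𝔞} e_l` are orthonormal. -/
def weyl {n : ℕ} (z : Fin n → ℂ) : Fock n →L[ℂ] Fock n :=
  (orthonormal_expVec z).orthogonalFamily.linearIsometry.toContinuousLinearMap

theorem weyl_fockBasis {n : ℕ} (z : Fin n → ℂ) (l : Fin n → ℕ) :
    HasSum (expTerm z l) (weyl z (fockBasis l)) := by
  have : weyl z (fockBasis l) = expVec z l := by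
    simp [weyl, fockBasis]
  rw [this]
  exact (summable_norm_expTerm z l).of_norm.hasSum

/-! ### States, moments and the characteristic function -/

/-- `ρ` is a density matrix: a positive operator of trace one. -/
def IsDensity {n : ℕ} (ρ : Fock n →L[ℂ] Fock n) : Prop :=
  ρ.IsPositive ∧ HasSum (fun k : Fin n → ℕ => inner ℂ (fockBasis k) (ρ (fockBasis k))) 1

/-- The `m`-th order moments of `ρ` are finite: `tr (N̂^{m/2} ρ) < ∞` for the total number operator
`N̂ = ∑_j â_j† â_j`, which is diagonal in the basis `e_k` with eigenvalues `∑_j k_j`. -/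
def HasMoments {n : ℕ} (ρ : Fock n →L[ℂ] Fock n) (m : ℕ) : Prop :=
  Summable fun k : Fin n → ℕ =>
    (∑ j, (k j : ℝ)) ^ ((m : ℝ) / 2) * (inner ℂ (fockBasis k) (ρ (fockBasis k))).re

/-- The diagonal matrix element `⟨e_k, A ρ e_k⟩` for `A` a polynomial in the creation and
annihilation operators; `tr (A ρ)` is the sum of these over `k`. -/
def diagEntry {n : ℕ} (A : Module.End ℂ (FockSeq n)) (ρ : Fock n →L[ℂ] Fock n)
    (k : Fin n → ℕ) : ℂ :=
  A (ρ (fockBasis k) : FockSeq n) k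

/-- The diagonal matrix element `⟨e_k, e^{i 𝐳ᵀ 𝔞} ρ e_k⟩`. -/
def charEntry {n : ℕ} (ρ : Fock n →L[ℂ] Fock n) (z : Fin n → ℂ) (k : Fin n → ℕ) : ℂ :=
  inner ℂ (fockBasis k) (weyl z (ρ (fockBasis k)))

/-- The characteristic function `h(𝐳) = tr (e^{i 𝐳ᵀ 𝔞} ρ)`, as a function of
`z = (z_1, …, z_n)`. -/
def charFunction {n : ℕ} (ρ : Fock n →L[ℂ] Fock n) (z : Fin n → ℂ) : ℂ :=
  ∑' k, charEntry ρ z k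

/-! ### The differential operators -/

/-- The components `∂/∂z_j` and `∂/∂z̄_j` of `∂/∂𝐳` (Wirtinger derivatives). -/
def wirtinger {n : ℕ} (c : Fin n ⊕ Fin n) (f : (Fin n → ℂ) → ℂ) (z : Fin n → ℂ) : ℂ :=
  match c with
  | Sum.inl j => (fderiv ℝ f z (Pi.single j 1) - Complex.I * fderiv ℝ f z (Pi.single j Complex.I)) / 2
  | Sum.inr j => (fderiv ℝ f z (Pi.single j 1) + Complex.I * fderiv ℝ f z (Pi.single j Complex.I)) / 2

/-- The operator `gᵀ (∂/∂(i𝐳) - ½ J (i𝐳))`, with `J = [[0, -I], [I, 0]]`. -/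
def diffOp {n : ℕ} (g : Fin n ⊕ Fin n → ℂ) (f : (Fin n → ℂ) → ℂ) (z : Fin n → ℂ) : ℂ :=
  ∑ c, g c * (Complex.I⁻¹ * wirtinger c f z
    - 1 / 2 * (Matrix.J (Fin n) ℂ).mulVec (Complex.I • boldVec z) c * f z)

/-- The differential operators of `g_1, …, g_m` applied successively, that of `g_1` first. -/
def iterDiffOp {n : ℕ} (gs : List (Fin n ⊕ Fin n → ℂ)) (f : (Fin n → ℂ) → ℂ) :
    (Fin n → ℂ) → ℂ :=
  gs.foldl (fun f g => diffOp g f) f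

end

noncomputable section

/-! The algebra: write W(z) for the Weyl operator. Commutators of linear forms are scalars, so the
derivative of W(z) in the direction w is i (𝐰ᵀ𝔞) W(z) − ½ [𝐳ᵀ𝔞, 𝐰ᵀ𝔞] W(z). The term with J removes
exactly the scalar part, so the operator of g sends tr(g₁ᵀ𝔞 ⋯ g_rᵀ𝔞 W(z) ρ) to the same trace with
gᵀ𝔞 inserted just before W(z) (`diffOp_weylMoment`). Starting from h, m such steps and W(0) = 1 give
the formula.

The analysis: these traces must converge and be differentiable under the sum, although a moment of
order m controls the weight (1 + N̂)^{m/2} only as a quadratic form. Let T be a product of at most m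
linear forms times W(z). Moving the forms to the right of W(z), or transposing them onto the other
vector, bounds T and its transpose by the norm of (1 + N̂)^{m/2} u (`exists_linProd_weyl`,
`exists_transpose`). Interpolating halfway between the two bounds (`CStarAlgebra.norm_sq_conj_le`)
splits the weight evenly and makes T a bounded form with respect to that weight
(`bilinBound_linProd_weyl`).

Factoring finite blocks of ρ as B*B and applying Cauchy–Schwarz then gives absolute convergence of
tr(Tρ), with a truncation error that tends to zero locally uniformly in z (`BilinBound.trace`). The
truncated traces are finite sums of differentiable matrix elements, so differentiability passes to
the limit (`hasFDerivAt_weylMoment`), each derivative costing one more linear form. -/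

/-! ### Interpolation between weighted operator bounds -/

theorem spectrum.spectralRadius_mul_comm_le {A : Type*} [NormedRing A] [NormedAlgebra ℂ A]
    (a b : A) : spectralRadius ℂ (a * b) ≤ spectralRadius ℂ (b * a) := by
  refine iSup₂_le fun k hk => ?_
  rcases eq_or_ne k 0 with rfl | h0
  · simp
  · have : k ∈ spectrum ℂ (a * b) \ {0} := ⟨hk, h0⟩
    rw [spectrum.nonzero_mul_comm] at this
    exact le_iSup₂ (f := fun k (_ : k ∈ spectrum ℂ (b * a)) => (‖k‖₊ : ENNReal)) k this.1

/-- By the C*-identity the left side is the norm of the self-adjoint element K T* K² T K, hence its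
spectral radius. Unlike the norm, the spectral radius is invariant under cyclic permutation, so the
last K may be moved to the front; only then is it bounded by a norm. -/
theorem CStarAlgebra.norm_sq_conj_le {A : Type*} [CStarAlgebra A] {K : A} (hK : IsSelfAdjoint K)
    (T : A) : ‖K * T * K‖ ^ 2 ≤ ‖T * (K * K)‖ * ‖K * K * T‖ := by
  nontriviality A
  have hX : IsSelfAdjoint (star (K * T * K) * (K * T * K)) := IsSelfAdjoint.star_mul_self _
  have h1 : ‖K * T * K‖ ^ 2 = ‖star (K * T * K) * (K * T * K)‖ := by
    rw [CStarRing.norm_star_mul_self, sq]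
  have h2 : spectralRadius ℂ (star (K * T * K) * (K * T * K))
      ≤ spectralRadius ℂ (K * K * star T * (K * K * T)) := by
    have e1 : star (K * T * K) * (K * T * K) = (K * star T * (K * K * T)) * K := by
      simp only [star_mul, hK.star_eq, mul_assoc]
    have e2 : K * K * star T * (K * K * T) = K * (K * star T * (K * K * T)) := by
      simp only [mul_assoc]
    rw [e1, e2]
    exact spectrum.spectralRadius_mul_comm_le _ _
  have h3 : star (T * (K * K)) = K * K * star T := by
    simp only [star_mul, hK.star_eq]
  have h4 := h2.trans
    (spectrum.spectralRadius_le_nnnorm (𝕜 := ℂ) (K * K * star T * (K * K * T)))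
  rw [hX.spectralRadius_eq_nnnorm] at h4
  have h5 : ‖star (K * T * K) * (K * T * K)‖ ≤ ‖K * K * star T * (K * K * T)‖ := by
    exact_mod_cast h4
  rw [h1, ← norm_star (T * (K * K)), h3]
  exact h5.trans (norm_mul_le _ _)

open scoped Matrix.Norms.L2Operator in
-- With K = diag(w^{-1/2}), the hypotheses say ‖T K²‖ ≤ C and ‖K² T‖ ≤ C. The interpolation
-- inequality yields ‖K T K‖ ≤ C, which is the claim after the factors √w are absorbed into u and v.
theorem Matrix.norm_bilin_le_of_weights {ι : Type*} [Fintype ι] [DecidableEq ι] (T : Matrix ι ι ℂ)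
    {w : ι → ℝ} (hw : ∀ k, 0 < w k) {C : ℝ} (hC : 0 ≤ C)
    (h1 : ∀ v : ι → ℂ, ∑ k, ‖∑ l, T k l * v l‖ ^ 2 ≤ C ^ 2 * ∑ l, w l ^ 2 * ‖v l‖ ^ 2)
    (h2 : ∀ u : ι → ℂ, ∑ l, ‖∑ k, u k * T k l‖ ^ 2 ≤ C ^ 2 * ∑ k, w k ^ 2 * ‖u k‖ ^ 2)
    (u v : ι → ℂ) :
    ‖∑ k, ∑ l, u k * T k l * v l‖
      ≤ C * √(∑ k, w k * ‖u k‖ ^ 2) * √(∑ l, w l * ‖v l‖ ^ 2) := by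
  set K : Matrix ι ι ℂ := Matrix.diagonal fun k => (((√(w k))⁻¹ : ℝ) : ℂ) with hKdef
  have hK : IsSelfAdjoint K := by
    rw [IsSelfAdjoint, Matrix.star_eq_conjTranspose, hKdef, Matrix.diagonal_conjTranspose]
    congr 1
    funext k
    simp
  have hKK : K * K = Matrix.diagonal fun k => (((w k)⁻¹ : ℝ) : ℂ) := by
    rw [hKdef, Matrix.diagonal_mul_diagonal]
    congr 1
    funext k
    rw [← Complex.ofReal_mul, ← mul_inv, Real.mul_self_sqrt (hw k).le]
  have hop : ∀ S : Matrix ι ι ℂ,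
      (∀ v : ι → ℂ, ∑ k, ‖∑ l, S k l * v l‖ ^ 2 ≤ C ^ 2 * ∑ l, ‖v l‖ ^ 2) → ‖S‖ ≤ C := by
    intro S hS
    rw [Matrix.l2_opNorm_def]
    refine ContinuousLinearMap.opNorm_le_bound _ hC fun x => ?_
    rw [← sq_le_sq₀ (norm_nonneg _) (by positivity), mul_pow, EuclideanSpace.norm_sq_eq,
      EuclideanSpace.norm_sq_eq]
    simpa [Matrix.mulVec, dotProduct] using hS x
  have hcancel : ∀ (k : ι) (x : ℂ), w k ^ 2 * ‖(((w k)⁻¹ : ℝ) : ℂ) * x‖ ^ 2 = ‖x‖ ^ 2 := by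
    intro k x
    have := (hw k).ne'
    rw [norm_mul, Complex.norm_real, Real.norm_eq_abs, mul_pow, sq_abs]
    field_simp
  have b1 : ‖T * (K * K)‖ ≤ C := by
    refine hop _ fun v => ?_
    have := h1 fun l => (((w l)⁻¹ : ℝ) : ℂ) * v l
    simp only [hcancel] at this
    simpa [hKK, Matrix.mul_diagonal, mul_assoc] using this
  have b2 : ‖K * K * T‖ ≤ C := by
    rw [← Matrix.l2_opNorm_conjTranspose]
    refine hop _ fun v => ?_
    -- The hypothesis concerns the transpose, the operator norm the adjoint; conjugating v passes
    -- between them.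
    have := h2 fun l => (((w l)⁻¹ : ℝ) : ℂ) * star (v l)
    simp only [hcancel, norm_star] at this
    refine le_trans (le_of_eq ?_) this
    refine Finset.sum_congr rfl fun l _ => ?_
    rw [← norm_star (∑ k, _)]
    congr 2
    rw [star_sum]
    refine Finset.sum_congr rfl fun k _ => ?_
    rw [hKK, Matrix.conjTranspose_apply, Matrix.diagonal_mul]
    simp
    ring
  have b3 : ‖K * T * K‖ ≤ C := by
    rw [← sq_le_sq₀ (norm_nonneg _) hC]
    refine (CStarAlgebra.norm_sq_conj_le hK T).trans ?_
    rw [sq]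
    gcongr
  -- The conjugate compensates for the inner product being conjugate-linear in its first argument.
  let x : EuclideanSpace ℂ ι := WithLp.toLp 2 fun k => star ((√(w k) : ℂ) * u k)
  let y : EuclideanSpace ℂ ι := WithLp.toLp 2 fun k => (√(w k) : ℂ) * v k
  have hnorm : ∀ (k : ι) (a : ℂ), ‖(√(w k) : ℂ) * a‖ ^ 2 = w k * ‖a‖ ^ 2 := by
    intro k a
    rw [norm_mul, mul_pow, Complex.norm_real, Real.norm_eq_abs, sq_abs, Real.sq_sqrt (hw k).le]
  have hx : ‖x‖ = √(∑ k, w k * ‖u k‖ ^ 2) := by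
    rw [EuclideanSpace.norm_eq]
    simp only [x, norm_star, hnorm]
  have hy : ‖y‖ = √(∑ k, w k * ‖v k‖ ^ 2) := by
    rw [EuclideanSpace.norm_eq]
    simp only [y, hnorm]
  have hform : ∑ k, ∑ l, u k * T k l * v l
      = inner ℂ x (Matrix.toEuclideanCLM (𝕜 := ℂ) (K * T * K) y) := by
    rw [PiLp.inner_apply]
    refine Finset.sum_congr rfl fun k _ => ?_
    simp only [Matrix.ofLp_toEuclideanCLM, Matrix.mulVec, dotProduct, RCLike.inner_apply, x, y,
      Finset.sum_mul]
    refine Finset.sum_congr rfl fun l _ => ?_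
    rw [hKdef, Matrix.mul_diagonal, Matrix.diagonal_mul]
    have hk : (√(w k) : ℂ) ≠ 0 := by exact_mod_cast (Real.sqrt_pos.2 (hw k)).ne'
    have hl : (√(w l) : ℂ) ≠ 0 := by exact_mod_cast (Real.sqrt_pos.2 (hw l)).ne'
    simp
    field_simp
  rw [hform, ← hx, ← hy]
  refine (norm_inner_le_norm _ _).trans ?_
  have := (Matrix.toEuclideanCLM (𝕜 := ℂ) (K * T * K)).le_opNorm y
  rw [← Matrix.cstar_norm_def] at this
  calc ‖x‖ * _ ≤ ‖x‖ * (‖K * T * K‖ * ‖y‖) := by gcongr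
    _ ≤ ‖x‖ * (C * ‖y‖) := by gcongr
    _ = _ := by ring

/-! ### Bounded forms and their traces against positive kernels -/

/-- `T` is a bilinear form on finitely supported vectors that is bounded by `C` in the `ℓ²`-norms
with weight `w`. -/
def BilinBound {ι : Type*} (T : ι → ι → ℂ) (w : ι → ℝ) (C : ℝ) : Prop :=
  ∀ (s : Finset ι) (u v : ι → ℂ), ‖∑ k ∈ s, ∑ l ∈ s, u k * T k l * v l‖
    ≤ C * √(∑ k ∈ s, w k * ‖u k‖ ^ 2) * √(∑ l ∈ s, w l * ‖v l‖ ^ 2)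

theorem BilinBound.two_sets {ι : Type*} [DecidableEq ι] {T : ι → ι → ℂ} {w : ι → ℝ} {C : ℝ}
    (h : BilinBound T w C) (s t : Finset ι) (u v : ι → ℂ) :
    ‖∑ k ∈ s, ∑ l ∈ t, u k * T k l * v l‖
      ≤ C * √(∑ k ∈ s, w k * ‖u k‖ ^ 2) * √(∑ l ∈ t, w l * ‖v l‖ ^ 2) := by
  have h' := h (s ∪ t) (fun k => if k ∈ s then u k else 0) (fun l => if l ∈ t then v l else 0)
  have e1 : ∀ f : ι → ℝ, ∑ k ∈ s ∪ t, (if k ∈ s then f k else 0) = ∑ k ∈ s, f k := fun f => by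
    rw [← Finset.sum_filter, Finset.filter_mem_eq_inter,
      Finset.inter_eq_right.2 Finset.subset_union_left]
  have e2 : ∀ f : ι → ℝ, ∑ k ∈ s ∪ t, (if k ∈ t then f k else 0) = ∑ k ∈ t, f k := fun f => by
    rw [← Finset.sum_filter, Finset.filter_mem_eq_inter,
      Finset.inter_eq_right.2 Finset.subset_union_right]
  have e3 : ∀ f : ι → ℂ, ∑ k ∈ s ∪ t, (if k ∈ s then f k else 0) = ∑ k ∈ s, f k := fun f => by
    rw [← Finset.sum_filter, Finset.filter_mem_eq_inter,
      Finset.inter_eq_right.2 Finset.subset_union_left]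
  have e4 : ∀ f : ι → ℂ, ∑ k ∈ s ∪ t, (if k ∈ t then f k else 0) = ∑ k ∈ t, f k := fun f => by
    rw [← Finset.sum_filter, Finset.filter_mem_eq_inter,
      Finset.inter_eq_right.2 Finset.subset_union_right]
  have f1 : ∀ (k : ι) (p : Prop) [Decidable p] (x : ℂ), w k * ‖if p then x else 0‖ ^ 2
      = if p then w k * ‖x‖ ^ 2 else 0 := fun k p _ x => by split_ifs <;> simp
  have f2 : ∀ k l, (if k ∈ s then u k else 0) * T k l * (if l ∈ t then v l else 0)
      = if l ∈ t then (if k ∈ s then u k * T k l * v l else 0) else 0 := fun k l => by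
    split_ifs <;> simp
  simp only [f1, f2, e1, e2, e4] at h'
  rw [Finset.sum_congr rfl fun k _ => show
    (∑ l ∈ t, if k ∈ s then u k * T k l * v l else 0)
      = if k ∈ s then ∑ l ∈ t, u k * T k l * v l else 0 by split_ifs <;> simp, e3] at h'
  exact h'

/-- The two operator bounds cost w², the form bound only w. This gain is what lets moments of order
m suffice for products of m linear forms. -/
theorem BilinBound.of_weights {ι : Type*} [DecidableEq ι] {T : ι → ι → ℂ} {w : ι → ℝ}
    (hw : ∀ k, 0 < w k) {C : ℝ} (hC : 0 ≤ C)
    (h1 : ∀ (s : Finset ι) (v : ι → ℂ),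
      ∑ k ∈ s, ‖∑ l ∈ s, T k l * v l‖ ^ 2 ≤ C ^ 2 * ∑ l ∈ s, w l ^ 2 * ‖v l‖ ^ 2)
    (h2 : ∀ (s : Finset ι) (u : ι → ℂ),
      ∑ l ∈ s, ‖∑ k ∈ s, u k * T k l‖ ^ 2 ≤ C ^ 2 * ∑ k ∈ s, w k ^ 2 * ‖u k‖ ^ 2) :
    BilinBound T w C := by
  intro s u v
  have ext : ∀ f : s → ℂ, ∃ f' : ι → ℂ, ∀ k : s, f' k = f k := fun f =>
    ⟨fun k => if h : k ∈ s then f ⟨k, h⟩ else 0, fun k => by simp⟩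
  have := Matrix.norm_bilin_le_of_weights (fun k l : s => T k l) (w := fun k : s => w k)
    (fun k => hw k) hC (fun v => ?_) (fun u => ?_) (fun k : s => u k) (fun k : s => v k)
  · simp only [Finset.sum_coe_sort s fun k => w k * ‖u k‖ ^ 2,
      Finset.sum_coe_sort s fun k => w k * ‖v k‖ ^ 2] at this
    rw [← Finset.sum_coe_sort s]
    simpa only [← Finset.sum_coe_sort s] using this
  · obtain ⟨v', hv'⟩ := ext v
    have := h1 s v'
    simpa only [← Finset.sum_coe_sort s, hv'] using this
  · obtain ⟨u', hu'⟩ := ext u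
    have := h2 s u'
    simpa only [← Finset.sum_coe_sort s, hu'] using this

open scoped ComplexOrder in
/-- `R` is a positive semidefinite kernel. -/
def PosKernel {ι : Type*} (R : ι → ι → ℂ) : Prop :=
  ∀ s : Finset ι, (Matrix.of fun k l : s => R k l).PosSemidef

open scoped ComplexOrder MatrixOrder in
-- Factoring finite blocks takes the place of a square root of the whole kernel.
theorem PosKernel.exists_factor {ι : Type*} {R : ι → ι → ℂ} (hR : PosKernel R) (s : Finset ι) :
    ∃ B : s → ι → ℂ, ∀ k ∈ s, ∀ l ∈ s, R k l = ∑ j, star (B j k) * B j l := by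
  classical
  obtain ⟨B, hB⟩ := CStarAlgebra.nonneg_iff_eq_star_mul_self.1 (hR s).nonneg
  refine ⟨fun j k => if h : k ∈ s then B j ⟨k, h⟩ else 0, fun k hk l hl => ?_⟩
  have := congrFun (congrFun hB ⟨k, hk⟩) ⟨l, hl⟩
  simpa [Matrix.mul_apply, hk, hl] using this

theorem PosKernel.re_nonneg {ι : Type*} {R : ι → ι → ℂ} (hR : PosKernel R) (k : ι) :
    0 ≤ (R k k).re := by
  obtain ⟨B, hB⟩ := hR.exists_factor {k}
  rw [hB k (by simp) k (by simp), Complex.re_sum]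
  refine Finset.sum_nonneg fun j _ => ?_
  simp only [Complex.star_def, ← Complex.normSq_eq_conj_mul_self, Complex.ofReal_re]
  exact Complex.normSq_nonneg _

/-- Factoring R as B*B on s ∪ t turns the sum into values of the form at the rows of B. The form
bound applies to each row, and Cauchy–Schwarz over the rows reassembles the diagonal of R. The
factors θ are there so that phases can be chosen to give absolute convergence. -/
theorem BilinBound.norm_trace_le {ι : Type*} [DecidableEq ι] {T R : ι → ι → ℂ} {w : ι → ℝ} {C : ℝ}
    (hw : ∀ k, 0 < w k) (hC : 0 ≤ C) (h : BilinBound T w C) (hR : PosKernel R)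
    (s t : Finset ι) (θ : ι → ℂ) (hθ : ∀ k, ‖θ k‖ ≤ 1) :
    ‖∑ k ∈ s, ∑ l ∈ t, θ k * T k l * R l k‖
      ≤ C * √(∑ k ∈ s, w k * (R k k).re) * √(∑ l ∈ t, w l * (R l l).re) := by
  obtain ⟨B, hB⟩ := hR.exists_factor (s ∪ t)
  have e1 : ∑ k ∈ s, ∑ l ∈ t, θ k * T k l * R l k
      = ∑ j, ∑ k ∈ s, ∑ l ∈ t, (θ k * B j k) * T k l * star (B j l) := by
    rw [Finset.sum_comm (s := Finset.univ)]
    refine Finset.sum_congr rfl fun k hk => ?_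
    rw [Finset.sum_comm (s := Finset.univ)]
    refine Finset.sum_congr rfl fun l hl => ?_
    rw [hB l (Finset.mem_union_right _ hl) k (Finset.mem_union_left _ hk), Finset.mul_sum]
    exact Finset.sum_congr rfl fun j _ => by ring
  have e2 : ∀ r ⊆ s ∪ t, ∑ k ∈ r, w k * (R k k).re = ∑ j, ∑ k ∈ r, w k * ‖B j k‖ ^ 2 := by
    intro r hr
    rw [Finset.sum_comm]
    refine Finset.sum_congr rfl fun k hk => ?_
    rw [hB k (hr hk) k (hr hk), Complex.re_sum, Finset.mul_sum]
    refine Finset.sum_congr rfl fun j _ => ?_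
    rw [Complex.star_def, ← Complex.normSq_eq_conj_mul_self, Complex.ofReal_re,
      Complex.normSq_eq_norm_sq]
  have nn : ∀ (r : Finset ι) (f : ι → ℂ), 0 ≤ ∑ k ∈ r, w k * ‖f k‖ ^ 2 := fun r f =>
    Finset.sum_nonneg fun k _ => mul_nonneg (hw k).le (by positivity)
  rw [e1, e2 s Finset.subset_union_left, e2 t Finset.subset_union_right]
  have h1 : ∀ j, ‖∑ k ∈ s, ∑ l ∈ t, (θ k * B j k) * T k l * star (B j l)‖
      ≤ C * (√(∑ k ∈ s, w k * ‖B j k‖ ^ 2) * √(∑ l ∈ t, w l * ‖B j l‖ ^ 2)) := by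
    intro j
    refine (h.two_sets s t _ _).trans ?_
    simp only [norm_star]
    rw [mul_assoc]
    have : ∑ k ∈ s, w k * ‖θ k * B j k‖ ^ 2 ≤ ∑ k ∈ s, w k * ‖B j k‖ ^ 2 := by
      refine Finset.sum_le_sum fun k _ => mul_le_mul_of_nonneg_left ?_ (hw k).le
      rw [norm_mul]
      have := hθ k
      gcongr
      exact mul_le_of_le_one_left (norm_nonneg _) this
    gcongr
  refine (norm_sum_le _ _).trans ((Finset.sum_le_sum fun j _ => h1 j).trans ?_)
  rw [← Finset.mul_sum, mul_assoc]
  refine mul_le_mul_of_nonneg_left ?_ hC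
  have := Real.sum_sqrt_mul_sqrt_le (Finset.univ : Finset ↥(s ∪ t)) (fun j => nn s (B j))
    (fun j => nn t (B j))
  exact this

/-- Each diagonal entry d k of the product is itself an infinite series. All estimates are therefore
made on finite rectangles, letting first the inner and then the outer index set grow. -/
theorem BilinBound.trace {ι : Type*} [DecidableEq ι] {T R : ι → ι → ℂ} {w : ι → ℝ} {C : ℝ}
    (hw : ∀ k, 0 < w k) (hC : 0 ≤ C) (h : BilinBound T w C) (hR : PosKernel R)
    (hsum : Summable fun k => w k * (R k k).re) {d : ι → ℂ}
    (hd : ∀ k, HasSum (fun l => T k l * R l k) (d k)) :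
    Summable d ∧ ∀ s : Finset ι, ‖∑' k, d k - ∑ k ∈ s, ∑ l ∈ s, T k l * R l k‖
      ≤ 2 * C * √(∑' k, w k * (R k k).re)
        * √(∑' k, w k * (R k k).re - ∑ k ∈ s, w k * (R k k).re) := by
  set tot := ∑' k, w k * (R k k).re with htot
  have hnn : ∀ k, 0 ≤ w k * (R k k).re := fun k => mul_nonneg (hw k).le (hR.re_nonneg k)
  have hle : ∀ s : Finset ι, ∑ k ∈ s, w k * (R k k).re ≤ tot := fun s =>
    hsum.sum_le_tsum s fun k _ => hnn k
  have hS : Summable d := by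
    refine Summable.of_norm (summable_of_sum_le (c := C * √tot * √tot) (fun k => norm_nonneg _)
      fun s => ?_)
    -- These phases turn a bound on a norm of a sum into a bound on the sum of the norms.
    have hθ : ∀ k, ∃ θ : ℂ, ‖θ‖ ≤ 1 ∧ θ * d k = (‖d k‖ : ℂ) := by
      intro k
      by_cases h0 : d k = 0
      · exact ⟨0, by simp, by simp [h0]⟩
      · refine ⟨(‖d k‖ : ℂ) / d k, ?_, by field_simp⟩
        rw [norm_div, Complex.norm_real, norm_norm, div_self (norm_ne_zero_iff.2 h0)]
    choose θ hθ1 hθ2 using hθ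
    have lim : Filter.Tendsto (fun t : Finset ι => ‖∑ k ∈ s, ∑ l ∈ t, θ k * T k l * R l k‖)
        Filter.atTop (nhds ‖∑ k ∈ s, θ k * d k‖) := by
      refine (tendsto_finsetSum _ fun k _ => ?_).norm
      have := (hd k).mul_left (θ k)
      simp only [← mul_assoc] at this
      exact this
    have e : ‖∑ k ∈ s, θ k * d k‖ = ∑ k ∈ s, ‖d k‖ := by
      simp only [hθ2]
      rw [← Complex.ofReal_sum, Complex.norm_real, Real.norm_eq_abs,
        abs_of_nonneg (Finset.sum_nonneg fun _ _ => norm_nonneg _)]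
    rw [← e]
    refine le_of_tendsto' lim fun t => (h.norm_trace_le hw hC hR s t θ hθ1).trans ?_
    gcongr
    · exact hle s
    · exact hle t
  refine ⟨hS, fun s => ?_⟩
  have h1 : ∀ t u : Finset ι, ‖∑ k ∈ t, ∑ l ∈ u, T k l * R l k‖
      ≤ C * √(∑ k ∈ t, w k * (R k k).re) * √(∑ l ∈ u, w l * (R l l).re) := fun t u => by
    simpa using h.norm_trace_le hw hC hR t u (fun _ => 1) (by simp)
  have tail : ∀ t, s ⊆ t → ∑ k ∈ t \ s, w k * (R k k).re
      ≤ tot - ∑ k ∈ s, w k * (R k k).re := fun t ht => by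
    have := hle t
    rw [← Finset.sum_sdiff ht] at this
    linarith
  have step : ∀ t, s ⊆ t → ‖∑ k ∈ t, d k - ∑ k ∈ s, ∑ l ∈ s, T k l * R l k‖
      ≤ 2 * C * √tot * √(tot - ∑ k ∈ s, w k * (R k k).re) := by
    intro t ht
    have lim : Filter.Tendsto (fun u : Finset ι =>
        ‖∑ k ∈ t, ∑ l ∈ u, T k l * R l k - ∑ k ∈ s, ∑ l ∈ s, T k l * R l k‖)
        Filter.atTop (nhds ‖∑ k ∈ t, d k - ∑ k ∈ s, ∑ l ∈ s, T k l * R l k‖) :=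
      ((tendsto_finsetSum _ fun k _ => hd k).sub_const _).norm
    refine le_of_tendsto lim ?_
    filter_upwards [Filter.eventually_ge_atTop t] with u hu
    have hsu : s ⊆ u := ht.trans hu
    -- The rectangle minus the square is two blocks, each with one side disjoint from s; that side
    -- supplies the tail factor, and having two blocks gives the constant 2.
    have e : ∑ k ∈ t, ∑ l ∈ u, T k l * R l k - ∑ k ∈ s, ∑ l ∈ s, T k l * R l k
        = ∑ k ∈ t \ s, ∑ l ∈ u, T k l * R l k + ∑ k ∈ s, ∑ l ∈ u \ s, T k l * R l k := by
      rw [← Finset.sum_sdiff ht, add_sub_assoc, ← Finset.sum_sub_distrib]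
      congr 1
      refine Finset.sum_congr rfl fun k _ => ?_
      rw [← Finset.sum_sdiff hsu, add_sub_cancel_right]
    rw [e]
    refine (norm_add_le _ _).trans ((add_le_add (h1 _ _) (h1 _ _)).trans ?_)
    have a1 : √(∑ k ∈ t \ s, w k * (R k k).re) ≤ √(tot - ∑ k ∈ s, w k * (R k k).re) :=
      Real.sqrt_le_sqrt (tail t ht)
    have a2 : √(∑ k ∈ u \ s, w k * (R k k).re) ≤ √(tot - ∑ k ∈ s, w k * (R k k).re) :=
      Real.sqrt_le_sqrt (tail u hsu)
    have a3 : √(∑ k ∈ u, w k * (R k k).re) ≤ √tot := Real.sqrt_le_sqrt (hle u)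
    have a4 : √(∑ k ∈ s, w k * (R k k).re) ≤ √tot := Real.sqrt_le_sqrt (hle s)
    calc _ ≤ C * √(tot - ∑ k ∈ s, w k * (R k k).re) * √tot
          + C * √tot * √(tot - ∑ k ∈ s, w k * (R k k).re) := by gcongr
      _ = _ := by ring
  refine le_of_tendsto (hS.hasSum.sub_const _).norm ?_
  filter_upwards [Filter.eventually_ge_atTop s] with t ht using step t ht

/-! ### Ladder operators in coordinates -/

/-- The coefficient in `(â φ)_k = ladderCoeff c k * φ (ladderShift c k)`. -/
def ladderCoeff {n : ℕ} (c : Fin n ⊕ Fin n) (k : Fin n → ℕ) : ℂ :=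
  match c with
  | Sum.inl j => (√((k j : ℝ) + 1) : ℂ)
  | Sum.inr j => (√(k j : ℝ) : ℂ)

/-- The occupation numbers that the `k`-th coordinate of a ladder operator reads. -/
def ladderShift {n : ℕ} (c : Fin n ⊕ Fin n) (k : Fin n → ℕ) : Fin n → ℕ :=
  match c with
  | Sum.inl j => k + Pi.single j 1
  | Sum.inr j => k - Pi.single j 1

theorem ladder_apply {n : ℕ} (c : Fin n ⊕ Fin n) (φ : FockSeq n) (k : Fin n → ℕ) :
    ladder c φ k = ladderCoeff c k * φ (ladderShift c k) := by
  rcases c with j | j <;> rfl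

theorem linForm_eq_sum {n : ℕ} (g : Fin n ⊕ Fin n → ℂ) (φ : FockSeq n) :
    linForm g φ = ∑ c, g c • ladder c φ := by
  simp [linForm]

theorem linForm_apply {n : ℕ} (g : Fin n ⊕ Fin n → ℂ) (φ : FockSeq n) (k : Fin n → ℕ) :
    linForm g φ k = ∑ c, g c * (ladderCoeff c k * φ (ladderShift c k)) := by
  simp [linForm_eq_sum, ladder_apply]

/-- The topology is that of pointwise convergence: each output coordinate reads finitely many input
coordinates. This lets operators that are unbounded on the Hilbert space pass through convergent
series. -/
theorem continuous_linForm {n : ℕ} (g : Fin n ⊕ Fin n → ℂ) : Continuous (linForm g) := by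
  refine continuous_pi fun k => ?_
  simp only [linForm_apply]
  fun_prop

/-! ### The canonical commutation relations -/

/-- The commutator of two components of `𝔞`. -/
def ladderComm {n : ℕ} : Fin n ⊕ Fin n → Fin n ⊕ Fin n → ℂ
  | Sum.inl i, Sum.inr j => if i = j then 1 else 0
  | Sum.inr i, Sum.inl j => if i = j then -1 else 0
  | _, _ => 0

theorem annihilation_creation {n : ℕ} (i j : Fin n) (φ : FockSeq n) :
    annihilation i (creation j φ) = creation j (annihilation i φ)
      + (if i = j then (1 : ℂ) else 0) • φ := by
  funext k
  change (√((k i : ℝ) + 1) : ℂ) * ((√(((k + Pi.single i 1 : Fin n → ℕ) j : ℕ) : ℝ) : ℂ)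
      * φ (k + Pi.single i 1 - Pi.single j 1))
    = (√(k j : ℝ) : ℂ) * ((√((((k - Pi.single j 1 : Fin n → ℕ) i : ℕ) : ℝ) + 1) : ℂ)
      * φ (k - Pi.single j 1 + Pi.single i 1)) + (if i = j then (1 : ℂ) else 0) * φ k
  rcases eq_or_ne i j with rfl | hij
  · have h1 : (√((k i : ℝ) + 1) : ℂ) * (√((k i : ℝ) + 1) : ℂ) = k i + 1 := by
      rw [← Complex.ofReal_mul, Real.mul_self_sqrt (by positivity)]; push_cast; rfl
    -- At k i = 0 the truncated subtraction has no meaning as a shift, but the coefficient √0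
    -- removes the term.
    by_cases h0 : k i = 0
    · simp [h0]
    · have h2 : (√(k i : ℝ) : ℂ) * (√(k i : ℝ) : ℂ) = k i := by
        rw [← Complex.ofReal_mul, Real.mul_self_sqrt (by positivity)]; push_cast; rfl
      have h3 : (((k - Pi.single i 1 : Fin n → ℕ) i : ℕ) : ℝ) + 1 = k i := by
        have : (k - Pi.single i 1 : Fin n → ℕ) i + 1 = k i := by simp; omega
        exact_mod_cast this
      rw [sub_add_single h0, h3, add_tsub_cancel_right, ← mul_assoc, ← mul_assoc, h2]
      simp only [Pi.add_apply, Pi.single_eq_same]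
      push_cast
      rw [h1]
      simp
      ring
  · have h1 : (k + Pi.single i 1 : Fin n → ℕ) j = k j := by simp [hij.symm]
    have h2 : (k - Pi.single j 1 : Fin n → ℕ) i = k i := by simp [hij]
    rw [h1, h2, if_neg hij, zero_mul, add_zero]
    by_cases h0 : k j = 0
    · simp [h0]
    · have : k + Pi.single i 1 - Pi.single j 1 = k - Pi.single j 1 + Pi.single i 1 := by
        refine (tsub_add_eq_add_tsub fun l => ?_).symm
        rcases eq_or_ne l j with rfl | hl
        · simp; omega
        · simp [hl]
      rw [this]
      ring

theorem ladder_comm {n : ℕ} (c d : Fin n ⊕ Fin n) (φ : FockSeq n) :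
    ladder c (ladder d φ) = ladder d (ladder c φ) + ladderComm c d • φ := by
  rcases c with i | i <;> rcases d with j | j
  · change annihilation i (annihilation j φ) = annihilation j (annihilation i φ) + (0 : ℂ) • φ
    rw [zero_smul, add_zero]
    rcases eq_or_ne i j with rfl | hij
    · rfl
    funext k
    change (√((k i : ℝ) + 1) : ℂ) * ((√((((k + Pi.single i 1 : Fin n → ℕ) j : ℕ) : ℝ) + 1) : ℂ)
        * φ (k + Pi.single i 1 + Pi.single j 1))
      = (√((k j : ℝ) + 1) : ℂ) * ((√((((k + Pi.single j 1 : Fin n → ℕ) i : ℕ) : ℝ) + 1) : ℂ)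
        * φ (k + Pi.single j 1 + Pi.single i 1))
    rw [add_right_comm]
    simp [hij, hij.symm]
    ring
  · exact annihilation_creation i j φ
  · change creation i (annihilation j φ) = annihilation j (creation i φ)
      + (if i = j then (-1 : ℂ) else 0) • φ
    rw [annihilation_creation j i]
    rcases eq_or_ne i j with rfl | hij
    · simp
    · simp [hij, hij.symm]
  · change creation i (creation j φ) = creation j (creation i φ) + (0 : ℂ) • φ
    rw [zero_smul, add_zero]
    rcases eq_or_ne i j with rfl | hij
    · rfl
    funext k
    change (√(k i : ℝ) : ℂ) * ((√(((k - Pi.single i 1 : Fin n → ℕ) j : ℕ) : ℝ) : ℂ)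
        * φ (k - Pi.single i 1 - Pi.single j 1))
      = (√(k j : ℝ) : ℂ) * ((√(((k - Pi.single j 1 : Fin n → ℕ) i : ℕ) : ℝ) : ℂ)
        * φ (k - Pi.single j 1 - Pi.single i 1))
    rw [tsub_right_comm]
    simp [hij, hij.symm]
    ring

/-- The commutator `[gᵀ 𝔞, g'ᵀ 𝔞]`. -/
def sympl {n : ℕ} (g g' : Fin n ⊕ Fin n → ℂ) : ℂ :=
  ∑ j, (g (Sum.inl j) * g' (Sum.inr j) - g (Sum.inr j) * g' (Sum.inl j))

theorem sum_ladderComm {n : ℕ} (g g' : Fin n ⊕ Fin n → ℂ) :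
    ∑ c, ∑ d, g c * g' d * ladderComm c d = sympl g g' := by
  simp [Fintype.sum_sum_type, ladderComm, sympl, Finset.sum_add_distrib, sub_eq_add_neg]
  ring

theorem linForm_comm {n : ℕ} (g g' : Fin n ⊕ Fin n → ℂ) (φ : FockSeq n) :
    linForm g (linForm g' φ) = linForm g' (linForm g φ) + sympl g g' • φ := by
  have h : ∀ a b : Fin n ⊕ Fin n → ℂ,
      linForm a (linForm b φ) = ∑ c, ∑ d, (a c * b d) • ladder c (ladder d φ) := fun a b => by
    rw [linForm_eq_sum, linForm_eq_sum]
    simp [Finset.smul_sum, smul_smul]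
  rw [h, h, Finset.sum_comm (f := fun c d => (g' c * g d) • ladder c (ladder d φ)),
    ← sum_ladderComm, Finset.sum_smul, ← Finset.sum_add_distrib]
  refine Finset.sum_congr rfl fun c _ => ?_
  rw [Finset.sum_smul, ← Finset.sum_add_distrib]
  refine Finset.sum_congr rfl fun d _ => ?_
  rw [ladder_comm c d, smul_add, smul_smul, mul_comm (g' d)]

/-- Passing each of the r + 1 factors leaves the same scalar commutator, which can be pulled out. -/
theorem linForm_pow_comm {n : ℕ} (g g' : Fin n ⊕ Fin n → ℂ) (r : ℕ) (φ : FockSeq n) :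
    linForm g ((linForm g' ^ (r + 1)) φ) = (linForm g' ^ (r + 1)) (linForm g φ)
      + ((r + 1 : ℂ) * sympl g g') • (linForm g' ^ r) φ := by
  induction r with
  | zero => simpa using linForm_comm g g' φ
  | succ r ih =>
    rw [pow_succ' _ (r + 1), Module.End.mul_apply, Module.End.mul_apply, linForm_comm, ih, map_add,
      map_smul]
    have : linForm g' ((linForm g' ^ r) φ) = (linForm g' ^ (r + 1)) φ := by
      rw [pow_succ']; rfl
    rw [this, add_assoc, ← add_smul]
    congr 2
    push_cast
    ring

/-! ### Weighted norms -/

/-- The square of the norm of `(1 + N̂)^{p/2} φ`. -/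
def wnorm {n : ℕ} (p : ℕ) (φ : FockSeq n) : ENNReal :=
  ∑' k, ((1 + ∑ j, k j : ℕ) : ENNReal) ^ p * ‖φ k‖ₑ ^ 2

theorem wnorm_mono {n p q : ℕ} (h : p ≤ q) (φ : FockSeq n) : wnorm p φ ≤ wnorm q φ := by
  refine ENNReal.tsum_le_tsum fun k => ?_
  gcongr
  exact_mod_cast Nat.le_add_right 1 _

theorem wnorm_smul {n : ℕ} (p : ℕ) (c : ℂ) (φ : FockSeq n) :
    wnorm p (c • φ) = ‖c‖ₑ ^ 2 * wnorm p φ := by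
  rw [wnorm, wnorm, ← ENNReal.tsum_mul_left]
  refine tsum_congr fun k => ?_
  rw [Pi.smul_apply, enorm_smul, mul_pow]
  ring

theorem enorm_add_sq_le (a b : ℂ) : ‖a + b‖ₑ ^ 2 ≤ 2 * (‖a‖ₑ ^ 2 + ‖b‖ₑ ^ 2) := by
  have h : ‖a + b‖₊ ^ 2 ≤ 2 * (‖a‖₊ ^ 2 + ‖b‖₊ ^ 2) := by
    rw [← NNReal.coe_le_coe]
    push_cast
    have := norm_add_le a b
    nlinarith [sq_nonneg (‖a‖ - ‖b‖), norm_nonneg (a + b), norm_nonneg a, norm_nonneg b]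
  simp only [enorm]
  exact_mod_cast h

theorem wnorm_add_le {n : ℕ} (p : ℕ) (φ ψ : FockSeq n) :
    wnorm p (φ + ψ) ≤ 2 * (wnorm p φ + wnorm p ψ) := by
  rw [wnorm, wnorm, wnorm, ← ENNReal.tsum_add, ← ENNReal.tsum_mul_left]
  refine ENNReal.tsum_le_tsum fun k => ?_
  rw [← mul_add, mul_left_comm]
  gcongr
  exact enorm_add_sq_le _ _

theorem wnorm_sum_le {n : ℕ} {ι : Type*} (p : ℕ) (s : Finset ι) (φ : ι → FockSeq n) :
    wnorm p (∑ i ∈ s, φ i) ≤ 2 ^ s.card * ∑ i ∈ s, wnorm p (φ i) := by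
  classical
  induction s using Finset.induction_on with
  | empty => simp [wnorm]
  | insert i s hi ih =>
    rw [Finset.sum_insert hi, Finset.sum_insert hi, Finset.card_insert_of_notMem hi, pow_succ',
      mul_assoc]
    refine (wnorm_add_le _ _ _).trans ?_
    gcongr
    rw [mul_add]
    gcongr
    exact le_mul_of_one_le_left' (one_le_pow₀ (by norm_num))

theorem enorm_sqrt_natCast_sq (a : ℕ) : ‖(√(a : ℝ) : ℂ)‖ₑ ^ 2 = a := by
  rw [← ofReal_norm, ← ENNReal.ofReal_pow (norm_nonneg _), Complex.norm_real,
    Real.norm_eq_abs, sq_abs, Real.sq_sqrt (Nat.cast_nonneg a), ENNReal.ofReal_natCast]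

/-- The squared coefficient costs one power of the weight. The factor 2^p comes from creation, where
the shift replaces 1 + |k| by 2 + |k| ≤ 2 (1 + |k|). -/
theorem wnorm_ladder_le {n : ℕ} (p : ℕ) (c : Fin n ⊕ Fin n) (φ : FockSeq n) :
    wnorm p (ladder c φ) ≤ 2 ^ p * wnorm (p + 1) φ := by
  rcases c with j | j
  · have hinj : Function.Injective (fun k : Fin n → ℕ => k + Pi.single j 1) :=
      fun _ _ h => add_right_cancel h
    refine le_trans ?_ ((ENNReal.tsum_comp_le_tsum_of_injective hinj _).trans
      (le_mul_of_one_le_left' (one_le_pow₀ (by norm_num) : (1 : ENNReal) ≤ 2 ^ p)))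
    refine ENNReal.tsum_le_tsum fun k => ?_
    rw [show ladder (Sum.inl j) φ k = (√(((k j + 1 : ℕ) : ℝ)) : ℂ) * φ (k + Pi.single j 1) by
      push_cast; rfl, enorm_mul, mul_pow, enorm_sqrt_natCast_sq, ← mul_assoc, pow_succ _ p]
    have h2 : k j ≤ ∑ i, k i := Finset.single_le_sum (fun _ _ => Nat.zero_le _) (by simp)
    rw [sum_add_single]
    refine mul_le_mul_left (mul_le_mul' (pow_le_pow_left' ?_ p) ?_) _
    · exact_mod_cast (by omega : 1 + ∑ i, k i ≤ 1 + (∑ i, k i + 1))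
    · exact_mod_cast (by omega : k j + 1 ≤ 1 + (∑ i, k i + 1))
  · have hinj : Function.Injective (fun k : Fin n → ℕ => k + Pi.single j 1) :=
      fun _ _ h => add_right_cancel h
    rw [wnorm, ← hinj.tsum_eq]
    · rw [wnorm, ← ENNReal.tsum_mul_left]
      refine ENNReal.tsum_le_tsum fun k => ?_
      rw [show ladder (Sum.inr j) φ (k + Pi.single j 1)
        = (√(((k + Pi.single j 1 : Fin n → ℕ) j : ℕ) : ℝ) : ℂ)
          * φ (k + Pi.single j 1 - Pi.single j 1) from rfl, add_tsub_cancel_right, enorm_mul,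
        mul_pow, enorm_sqrt_natCast_sq, ← mul_assoc, ← mul_assoc, pow_succ _ p, ← mul_assoc, ← mul_pow]
      have h2 : k j ≤ ∑ i, k i := Finset.single_le_sum (fun _ _ => Nat.zero_le _) (by simp)
      gcongr
      · rw [sum_add_single]
        exact_mod_cast (by omega : 1 + (∑ i, k i + 1) ≤ 2 * (1 + ∑ i, k i))
      · simp only [Pi.add_apply, Pi.single_eq_same]
        omega
    · intro k hk
      rw [Function.mem_support] at hk
      have h : k j ≠ 0 := by
        intro h
        apply hk
        rw [show ladder (Sum.inr j) φ k = (√(k j : ℝ) : ℂ) * φ (k - Pi.single j 1) from rfl]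
        simp [h]
      exact ⟨k - Pi.single j 1, sub_add_single h⟩

theorem wnorm_linForm_le {n : ℕ} (p : ℕ) (g : Fin n ⊕ Fin n → ℂ) :
    ∃ C : NNReal, ∀ φ : FockSeq n, wnorm p (linForm g φ) ≤ C * wnorm (p + 1) φ := by
  refine ⟨2 ^ (Finset.univ : Finset (Fin n ⊕ Fin n)).card * ∑ c, ‖g c‖₊ ^ 2 * 2 ^ p, fun φ => ?_⟩
  rw [linForm_eq_sum]
  refine (wnorm_sum_le _ _ _).trans ?_
  push_cast
  rw [mul_assoc, Finset.sum_mul]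
  gcongr with c
  rw [wnorm_smul, mul_assoc]
  exact mul_le_mul_right (wnorm_ladder_le p c φ) _

/-- The scalar a will be the commutator left by moving a form past the Weyl operator; the constant
must be uniform in it to give estimates locally uniform in z. -/
theorem wnorm_linForm_add_le {n : ℕ} (p : ℕ) (g : Fin n ⊕ Fin n → ℂ) (R : NNReal) :
    ∃ C : NNReal, ∀ (a : ℂ) (φ : FockSeq n), ‖a‖₊ ≤ R →
      wnorm p (linForm g φ + a • φ) ≤ C * wnorm (p + 1) φ := by
  obtain ⟨C, hC⟩ := wnorm_linForm_le p g
  refine ⟨2 * (C + R ^ 2), fun a φ ha => (wnorm_add_le _ _ _).trans ?_⟩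
  push_cast
  rw [mul_assoc, add_mul, wnorm_smul]
  gcongr
  · exact hC φ
  · exact ENNReal.coe_le_coe.2 ha
  · exact wnorm_mono (Nat.le_succ p) φ

/-! ### Products of linear forms and their transposes -/

/-- The product `g_1ᵀ 𝔞 ⋯ g_mᵀ 𝔞`. -/
def linProd {n : ℕ} (gs : List (Fin n ⊕ Fin n → ℂ)) : Module.End ℂ (FockSeq n) :=
  (gs.map linForm).prod

theorem linProd_nil {n : ℕ} (φ : FockSeq n) : linProd [] φ = φ := rfl

theorem linProd_cons {n : ℕ} (g : Fin n ⊕ Fin n → ℂ) (gs : List (Fin n ⊕ Fin n → ℂ))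
    (φ : FockSeq n) : linProd (g :: gs) φ = linForm g (linProd gs φ) := by
  simp [linProd]

theorem linProd_concat {n : ℕ} (g : Fin n ⊕ Fin n → ℂ) (gs : List (Fin n ⊕ Fin n → ℂ))
    (φ : FockSeq n) : linProd (gs ++ [g]) φ = linProd gs (linForm g φ) := by
  simp [linProd]

theorem continuous_linProd {n : ℕ} (gs : List (Fin n ⊕ Fin n → ℂ)) : Continuous (linProd gs) := by
  induction gs with
  | nil => exact continuous_id
  | cons g gs ih =>
    simp only [funext (linProd_cons g gs)]
    exact (continuous_linForm g).comp ih

theorem FinDeg.finite_support {n M : ℕ} {u : FockSeq n} (hu : FinDeg M u) :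
    (Function.support u).Finite := by
  refine (Finset.finite_toSet (Fintype.piFinset fun _ : Fin n => Finset.range (M + 1))).subset ?_
  intro k hk
  rw [Finset.mem_coe, Fintype.mem_piFinset]
  intro j
  rw [Finset.mem_range]
  by_contra h
  apply hk
  apply hu
  have h2 : k j ≤ ∑ i, k i := Finset.single_le_sum (fun _ _ => Nat.zero_le _) (by simp)
  omega

/-- The bilinear pairing of sequences. -/
def pairing {n : ℕ} (u φ : FockSeq n) : ℂ := ∑' k, u k * φ k

/-- No summability is required: the two series are reindexings of each other along k ↦ k + δ_j, and
the indices missed carry the coefficient √0. -/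
theorem pairing_annihilation {n : ℕ} (j : Fin n) (u φ : FockSeq n) :
    pairing u (annihilation j φ) = pairing (creation j u) φ := by
  have hinj : Function.Injective (fun k : Fin n → ℕ => k + Pi.single j 1) :=
    fun _ _ h => add_right_cancel h
  rw [pairing, pairing, ← hinj.tsum_eq (f := fun k => creation j u k * φ k)]
  · refine tsum_congr fun k => ?_
    change u k * ((√((k j : ℝ) + 1) : ℂ) * φ (k + Pi.single j 1))
      = (√(((k + Pi.single j 1 : Fin n → ℕ) j : ℕ) : ℝ) : ℂ)
        * u (k + Pi.single j 1 - Pi.single j 1) * φ (k + Pi.single j 1)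
    rw [add_tsub_cancel_right]
    simp
    ring
  · intro k hk
    rw [Function.mem_support] at hk
    have h : k j ≠ 0 := by
      intro h
      apply hk
      rw [show creation j u k = (√(k j : ℝ) : ℂ) * u (k - Pi.single j 1) from rfl]
      simp [h]
    exact ⟨k - Pi.single j 1, sub_add_single h⟩

theorem pairing_comm {n : ℕ} (u φ : FockSeq n) : pairing u φ = pairing φ u :=
  tsum_congr fun _ => mul_comm _ _

theorem pairing_ladder {n : ℕ} (c : Fin n ⊕ Fin n) (u φ : FockSeq n) :
    pairing u (ladder c φ) = pairing (ladder c.swap u) φ := by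
  rcases c with j | j
  · exact pairing_annihilation j u φ
  · rw [pairing_comm, pairing_comm (ladder _ u)]
    exact (pairing_annihilation j φ u).symm

theorem pairing_linForm {n M : ℕ} (g : Fin n ⊕ Fin n → ℂ) {u : FockSeq n} (hu : FinDeg M u)
    (φ : FockSeq n) : pairing u (linForm g φ) = pairing (linForm (g ∘ Sum.swap) u) φ := by
  have e1 : pairing u (linForm g φ) = ∑ c, g c * pairing u (ladder c φ) := by
    simp only [pairing, ← tsum_mul_left]
    rw [← Summable.tsum_finsetSum]
    · refine tsum_congr fun k => ?_
      rw [linForm_eq_sum, Finset.sum_apply, Finset.mul_sum]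
      exact Finset.sum_congr rfl fun c _ => by simp; ring
    · intro c _
      refine summable_of_hasFiniteSupport (hu.finite_support.subset fun k hk h => hk ?_)
      simp [show u k = 0 from h]
  have e2 : pairing (linForm (g ∘ Sum.swap) u) φ
      = ∑ c, g c.swap * pairing (ladder c u) φ := by
    simp only [pairing, ← tsum_mul_left]
    rw [← Summable.tsum_finsetSum]
    · refine tsum_congr fun k => ?_
      rw [linForm_eq_sum, Finset.sum_apply, Finset.sum_mul]
      exact Finset.sum_congr rfl fun c _ => by simp; ring
    · intro c _
      refine summable_of_hasFiniteSupport ((hu.apply_ladder c).finite_support.subset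
        fun k hk h => hk ?_)
      simp [show ladder c u k = 0 from h]
  rw [e1, e2, ← (Equiv.sumComm (Fin n) (Fin n)).sum_comp]
  refine Finset.sum_congr rfl fun c _ => ?_
  simp [pairing_ladder]

/-- All forms are moved onto the finitely supported vector, so that φ may be any sequence, in
particular the image of a basis vector under a Weyl operator. The constant is independent of u and
of its degree. -/
theorem exists_transpose {n : ℕ} (gs : List (Fin n ⊕ Fin n → ℂ)) (p : ℕ) :
    ∃ C : NNReal, ∀ (M : ℕ) (u : FockSeq n), FinDeg M u → ∃ (M' : ℕ) (u' : FockSeq n),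
      FinDeg M' u' ∧ (∀ φ, pairing u (linProd gs φ) = pairing u' φ) ∧
      wnorm p u' ≤ C * wnorm (p + gs.length) u := by
  induction gs with
  | nil => exact ⟨1, fun M u hu => ⟨M, u, hu, fun φ => rfl, by simp⟩⟩
  | cons g gs ih =>
    obtain ⟨C, hC⟩ := ih
    obtain ⟨D, hD⟩ := wnorm_linForm_le (p + gs.length) (g ∘ Sum.swap)
    refine ⟨C * D, fun M u hu => ?_⟩
    obtain ⟨M', u', h1, h2, h3⟩ := hC _ _ (hu.apply_linForm (g ∘ Sum.swap))
    refine ⟨M', u', h1, fun φ => ?_, h3.trans ?_⟩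
    · rw [linProd_cons, pairing_linForm g hu, h2]
    · push_cast
      rw [mul_assoc]
      gcongr
      exact hD u

/-! ### Moving linear forms past the Weyl operator -/

theorem hasSum_of_nat_shift {E : Type*} [AddCommGroup E] [TopologicalSpace E]
    [IsTopologicalAddGroup E] {f g : ℕ → E} {a : E} (N : ℕ) (h : HasSum g a)
    (h0 : ∀ r < N, f r = 0) (hfg : ∀ r, g r = f (r + N)) : HasSum f a := by
  rw [← hasSum_nat_add_iff' N, Finset.sum_eq_zero fun r hr => h0 r (Finset.mem_range.1 hr),
    sub_zero]
  exact (funext hfg : g = fun r => f (r + N)) ▸ h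

theorem inner_fockBasis {n : ℕ} (k : Fin n → ℕ) (u : Fock n) : inner ℂ (fockBasis k) u = u k := by
  rw [fockBasis, lp.inner_single_left]
  simp

theorem hasSum_fock_coe {n : ℕ} {ι : Type*} {f : ι → Fock n} {a : Fock n} (h : HasSum f a) :
    HasSum (fun i => (f i : FockSeq n)) (a : FockSeq n) := by
  rw [Pi.hasSum]
  intro k
  have := h.mapL (innerSL ℂ (fockBasis k))
  simpa [inner_fockBasis] using this

theorem hasSum_fockBasis {n : ℕ} (u : Fock n) : HasSum (fun l => u l • fockBasis l) u := by
  have h := lp.hasSum_single (p := 2) (by norm_num) u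
  convert h using 2 with l
  rw [fockBasis, ← lp.single_smul]
  simp

theorem FinDeg.eq_sum {n M : ℕ} {u : Fock n} (hu : FinDeg M (u : FockSeq n)) :
    u = ∑ l ∈ hu.finite_support.toFinset, u l • fockBasis l := by
  refine (hasSum_fockBasis u).unique (hasSum_sum_of_ne_finset_zero fun l hl => ?_)
  rw [Set.Finite.mem_toFinset, Function.mem_support, not_not] at hl
  rw [show u l = 0 from hl, zero_smul]

theorem hasSum_weyl_of_finDeg {n M : ℕ} (z : Fin n → ℂ) {u : Fock n}
    (hu : FinDeg M (u : FockSeq n)) :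
    HasSum (fun r : ℕ => (Complex.I ^ r / (r.factorial : ℂ)) •
      (linForm (boldVec z) ^ r) (u : FockSeq n)) (weyl z u : FockSeq n) := by
  have h : ∀ l, HasSum (fun r : ℕ => (Complex.I ^ r / (r.factorial : ℂ)) •
      (linForm (boldVec z) ^ r) (fockBasis l : FockSeq n)) (weyl z (fockBasis l) : FockSeq n) :=
    fun l => hasSum_fock_coe (weyl_fockBasis z l)
  have h2 := hasSum_sum (s := hu.finite_support.toFinset) fun l _ => (h l).const_smul (u l)
  have e : (u : FockSeq n) = ∑ l ∈ hu.finite_support.toFinset, u l • (fockBasis l : FockSeq n) := by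
    conv_lhs => rw [hu.eq_sum]
    rw [lp.coeFn_sum]
    rfl
  have e' : (weyl z u : FockSeq n)
      = ∑ l ∈ hu.finite_support.toFinset, u l • (weyl z (fockBasis l) : FockSeq n) := by
    conv_lhs => rw [hu.eq_sum]
    rw [map_sum, lp.coeFn_sum]
    simp
  rw [e']
  convert h2 using 2 with r
  refine (congrArg (fun x : FockSeq n => (Complex.I ^ r / (r.factorial : ℂ)) •
    (linForm (boldVec z) ^ r) x) e).trans ?_
  simp only [map_sum, Finset.smul_sum]
  refine Finset.sum_congr rfl fun l _ => ?_
  rw [map_smul, smul_comm]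

/-- Commuting the form through the r-th term of the exponential series leaves r times the scalar
commutator times the power r − 1; since r/r! = 1/(r − 1)!, these remainders sum to the exponential
again. -/
theorem linForm_weyl {n M : ℕ} (g : Fin n ⊕ Fin n → ℂ) (z : Fin n → ℂ) {u v : Fock n}
    (hu : FinDeg M (u : FockSeq n)) (hv : (v : FockSeq n) = linForm g (u : FockSeq n)) :
    linForm g (weyl z u : FockSeq n) = (weyl z v : FockSeq n)
      + (Complex.I * sympl g (boldVec z)) • (weyl z u : FockSeq n) := by
  have hu' := hasSum_weyl_of_finDeg z hu
  have hv' := hasSum_weyl_of_finDeg z (u := v) (M := M + 1) (by rw [hv]; exact hu.apply_linForm g)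
  rw [hv] at hv'
  have h1 := hu'.map (linForm g) (continuous_linForm g)
  have h2 := hu'.const_smul (Complex.I * sympl g (boldVec z))
  have h3 : HasSum (fun r : ℕ => (Complex.I ^ r / (r.factorial : ℂ)) •
      ((r : ℂ) * sympl g (boldVec z)) • (linForm (boldVec z) ^ (r - 1)) (u : FockSeq n))
      ((Complex.I * sympl g (boldVec z)) • (weyl z u : FockSeq n)) := by
    refine hasSum_of_nat_shift 1 h2 (by simp) fun r => ?_
    rw [smul_smul, smul_smul, Nat.factorial_succ, pow_succ, add_tsub_cancel_right]
    congr 1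
    have : (r.factorial : ℂ) ≠ 0 := by exact_mod_cast Nat.factorial_ne_zero r
    have : (r + 1 : ℂ) ≠ 0 := by exact_mod_cast Nat.succ_ne_zero r
    push_cast
    field_simp
  refine h1.unique ?_
  convert hv'.add h3 using 2 with r
  rw [Function.comp_apply, map_smul, ← smul_add]
  congr 1
  cases r with
  | zero => simp
  | succ r => rw [linForm_pow_comm]; push_cast; rfl

theorem norm_boldVec_le {n : ℕ} {z : Fin n → ℂ} {R : ℝ} (hz : ‖z‖ ≤ R) (c : Fin n ⊕ Fin n) :
    ‖boldVec z c‖ ≤ R := by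
  rcases c with j | j
  · exact (norm_le_pi_norm z j).trans hz
  · simpa [boldVec] using (norm_le_pi_norm z j).trans hz

theorem norm_sympl_boldVec_le {n : ℕ} (g : Fin n ⊕ Fin n → ℂ) {z : Fin n → ℂ} {R : ℝ}
    (hz : ‖z‖ ≤ R) : ‖sympl g (boldVec z)‖ ≤ (∑ c, ‖g c‖) * R := by
  rw [sympl, Fintype.sum_sum_type, ← Finset.sum_add_distrib, Finset.sum_mul]
  refine (norm_sum_le _ _).trans (Finset.sum_le_sum fun j _ => (norm_sub_le _ _).trans ?_)
  rw [norm_mul, norm_mul, add_mul]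
  gcongr <;> exact norm_boldVec_le hz _

/-- Each form reappears to the right of the Weyl operator with a scalar added that is bounded for
‖z‖ ≤ R. Weighted norms are thus only taken of finite-particle vectors, and no mapping property of
the Weyl operator between weighted spaces is needed. -/
theorem exists_linProd_weyl {n : ℕ} (gs : List (Fin n ⊕ Fin n → ℂ)) (R : ℝ) (p : ℕ) :
    ∃ C : NNReal, ∀ (z : Fin n → ℂ), ‖z‖ ≤ R → ∀ (M : ℕ) (u : Fock n), FinDeg M (u : FockSeq n) →
      ∃ (M' : ℕ) (v : Fock n), FinDeg M' (v : FockSeq n) ∧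
        linProd gs (weyl z u : FockSeq n) = (weyl z v : FockSeq n) ∧
        wnorm p (v : FockSeq n) ≤ C * wnorm (p + gs.length) (u : FockSeq n) := by
  induction gs generalizing p with
  | nil => exact ⟨1, fun z _ M u hu => ⟨M, u, hu, rfl, by simp⟩⟩
  | cons g gs ih =>
    obtain ⟨C, hC⟩ := ih (p + 1)
    obtain ⟨D, hD⟩ := wnorm_linForm_add_le p g ((∑ c, ‖g c‖) * R).toNNReal
    refine ⟨D * C, fun z hz M u hu => ?_⟩
    obtain ⟨M', v, h1, h2, h3⟩ := hC z hz M u hu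
    obtain ⟨x, hx, -⟩ := exists_linForm g v h1
    have hxv : ((x + (Complex.I * sympl g (boldVec z)) • v : Fock n) : FockSeq n)
        = linForm g (v : FockSeq n) + (Complex.I * sympl g (boldVec z)) • (v : FockSeq n) := by
      rw [← hx]; rfl
    refine ⟨M' + 1, x + (Complex.I * sympl g (boldVec z)) • v, ?_, ?_, ?_⟩
    · intro k hk
      rw [hxv, Pi.add_apply, h1.apply_linForm g k hk, Pi.smul_apply, h1 k (by omega)]
      simp
    · rw [linProd_cons, h2, linForm_weyl g z h1 hx, map_add, map_smul]
      rfl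
    · rw [hxv]
      refine (hD _ _ ?_).trans ?_
      · have := norm_sympl_boldVec_le g hz
        rw [← NNReal.coe_le_coe, coe_nnnorm, norm_mul, Complex.norm_I, one_mul]
        exact this.trans (Real.le_coe_toNNReal _)
      · push_cast
        rw [mul_assoc, List.length_cons, add_comm gs.length 1, ← add_assoc]
        gcongr

/-! ### Differentiability of the matrix elements -/

/-- The components of `z ↦ boldVec z` as real linear maps. -/
def boldCLM {n : ℕ} (c : Fin n ⊕ Fin n) : (Fin n → ℂ) →L[ℝ] ℂ :=
  match c with
  | Sum.inl j => ContinuousLinearMap.proj j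
  | Sum.inr j => (Complex.conjCLE : ℂ →L[ℝ] ℂ).comp (ContinuousLinearMap.proj j)

theorem boldCLM_apply {n : ℕ} (c : Fin n ⊕ Fin n) (z : Fin n → ℂ) :
    boldCLM c z = boldVec z c := by
  rcases c with j | j
  · rfl
  · simp [boldCLM, boldVec]

/-- The map `w ↦ [𝐳ᵀ 𝔞, 𝐰ᵀ 𝔞]`. -/
def symplCLM {n : ℕ} (z : Fin n → ℂ) : (Fin n → ℂ) →L[ℝ] ℂ :=
  ∑ j, (boldCLM (Sum.inl j) z • boldCLM (Sum.inr j) - boldCLM (Sum.inr j) z • boldCLM (Sum.inl j))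

theorem symplCLM_apply {n : ℕ} (z w : Fin n → ℂ) :
    symplCLM z w = sympl (boldVec z) (boldVec w) := by
  simp [symplCLM, sympl, boldCLM_apply]

/-- The map `w ↦ (𝐰ᵀ 𝔞 φ)_k`. -/
def linFormCLM {n : ℕ} (φ : FockSeq n) (k : Fin n → ℕ) : (Fin n → ℂ) →L[ℝ] ℂ :=
  ∑ c, (ladderCoeff c k * φ (ladderShift c k)) • boldCLM c

theorem linFormCLM_apply {n : ℕ} (φ : FockSeq n) (k : Fin n → ℕ) (w : Fin n → ℂ) :
    linFormCLM φ k w = linForm (boldVec w) φ k := by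
  simp only [linFormCLM, sum_apply, smul_apply,
    boldCLM_apply, linForm_apply, smul_eq_mul]
  exact Finset.sum_congr rfl fun c _ => by ring

/-- The derivative of `z ↦ ((𝐳ᵀ 𝔞)^r φ)_k`. -/
def powDeriv {n : ℕ} (φ : FockSeq n) (z : Fin n → ℂ) (r : ℕ) (k : Fin n → ℕ) :
    (Fin n → ℂ) →L[ℝ] ℂ :=
  (r : ℂ) • linFormCLM ((linForm (boldVec z) ^ (r - 1)) φ) k
    + ((r : ℂ) * (r - 1) / 2 * (linForm (boldVec z) ^ (r - 2)) φ k) • symplCLM z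

theorem powDeriv_apply {n : ℕ} (φ : FockSeq n) (z : Fin n → ℂ) (r : ℕ) (k : Fin n → ℕ)
    (w : Fin n → ℂ) : powDeriv φ z r k w
      = ((r : ℂ) • linForm (boldVec w) ((linForm (boldVec z) ^ (r - 1)) φ)
        + ((r : ℂ) * (r - 1) / 2 * sympl (boldVec z) (boldVec w)) •
          (linForm (boldVec z) ^ (r - 2)) φ) k := by
  simp only [powDeriv, add_apply, smul_apply,
    linFormCLM_apply, symplCLM_apply, Pi.add_apply, Pi.smul_apply, smul_eq_mul]
  ring

/-- With X = 𝐳ᵀ𝔞 and Y = 𝐰ᵀ𝔞, the product rule gives ∑ X^s Y X^{r−1−s}. Moving Y to the left past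
X^s costs s [X, Y] X^{s−1}, and these add up to r(r−1)/2 · [X, Y] X^{r−2}. -/
theorem hasFDerivAt_linForm_pow {n : ℕ} (φ : FockSeq n) (z : Fin n → ℂ) (r : ℕ) (k : Fin n → ℕ) :
    HasFDerivAt (fun z => (linForm (boldVec z) ^ r) φ k) (powDeriv φ z r k) z := by
  induction r generalizing k with
  | zero =>
    have : powDeriv φ z 0 k = 0 := by ext w; simp [powDeriv_apply]
    rw [this]
    exact hasFDerivAt_const _ _
  | succ r ih =>
    have h1 : (fun z => (linForm (boldVec z) ^ (r + 1)) φ k) = fun z => ∑ c, boldCLM c z *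
        (ladderCoeff c k * (linForm (boldVec z) ^ r) φ (ladderShift c k)) := by
      funext z
      rw [pow_succ', Module.End.mul_apply, linForm_apply]
      simp only [boldCLM_apply]
    rw [h1]
    have h2 := HasFDerivAt.fun_sum (u := Finset.univ) fun c _ =>
      (boldCLM c).hasFDerivAt.mul ((ih (ladderShift c k)).const_mul (ladderCoeff c k)) (x := z)
    refine h2.congr_fderiv ?_
    ext w
    have h3 : (∑ c, (boldCLM c z • ladderCoeff c k • powDeriv φ z r (ladderShift c k)
        + (ladderCoeff c k * (linForm (boldVec z) ^ r) φ (ladderShift c k)) • boldCLM c)) w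
        = linForm (boldVec z) ((r : ℂ) • linForm (boldVec w) ((linForm (boldVec z) ^ (r - 1)) φ)
          + ((r : ℂ) * (r - 1) / 2 * sympl (boldVec z) (boldVec w)) •
          (linForm (boldVec z) ^ (r - 2)) φ) k
          + linForm (boldVec w) ((linForm (boldVec z) ^ r) φ) k := by
      rw [linForm_apply, linForm_apply, ← Finset.sum_add_distrib]
      simp only [← powDeriv_apply]
      simp only [sum_apply, add_apply,
        smul_apply, boldCLM_apply, smul_eq_mul]
      exact Finset.sum_congr rfl fun c _ => by ring
    rw [h3, powDeriv_apply, map_add, map_smul, map_smul, linForm_comm (boldVec z) (boldVec w)]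
    have h4 : ∀ s, linForm (boldVec z) ((linForm (boldVec z) ^ s) φ)
        = (linForm (boldVec z) ^ (s + 1)) φ := fun s => by rw [pow_succ']; rfl
    rw [h4, h4]
    -- For exponents 0 and 1 the truncated subtractions r − 1 and r − 2 are harmless because their
    -- coefficients vanish.
    rcases r with _ | _ | r
    · simp
    · simp
      ring
    · simp only [Nat.add_sub_cancel, show r + 1 + 1 - 2 + 1 = r + 1 by omega,
        show r + 1 + 1 + 1 - 2 = r + 1 by omega]
      simp only [Pi.add_apply, Pi.smul_apply, smul_eq_mul]
      push_cast
      ring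

/-- A bound for the norm of the `r`-th term of the exponential series, up to the factorial. -/
def expMajorant (K : ℝ) (d r : ℕ) : ℝ := ∏ i ∈ Finset.range r, (K * √((d + i : ℕ) + 1))

theorem expMajorant_nonneg {K : ℝ} (hK : 0 ≤ K) (d r : ℕ) : 0 ≤ expMajorant K d r :=
  Finset.prod_nonneg fun _ _ => by positivity

theorem summable_expMajorant {K : ℝ} (hK : 0 ≤ K) (d : ℕ) :
    Summable fun r : ℕ => expMajorant K d r / r.factorial := by
  refine summable_of_ratio_norm_eventually_le (r := 1 / 2) (by norm_num) ?_
  -- Beyond this threshold K²(d + r + 1) ≤ K²(d + 1)(r + 1) ≤ (r + 1)²/4, so consecutive terms have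
  -- ratio at most 1/2.
  filter_upwards [Filter.eventually_ge_atTop ⌈4 * K ^ 2 * (d + 1)⌉₊] with r hr
  have hr' : 4 * K ^ 2 * (d + 1) ≤ r := (Nat.le_ceil _).trans (by exact_mod_cast hr)
  have hb := expMajorant_nonneg hK d r
  have hb' := expMajorant_nonneg hK d (r + 1)
  rw [Real.norm_of_nonneg (by positivity), Real.norm_of_nonneg (by positivity)]
  have h1 : K * √((d + r : ℕ) + 1) ≤ (r + 1) / 2 := by
    refine abs_le_of_sq_le_sq' ?_ (by positivity) |>.2
    rw [mul_pow, Real.sq_sqrt (by positivity)]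
    push_cast
    have hd : (0 : ℝ) ≤ d := by positivity
    have h0 : (0 : ℝ) ≤ r := by positivity
    have h2 : (d : ℝ) + r + 1 ≤ (d + 1) * (r + 1) := by nlinarith [mul_nonneg hd h0]
    have h3 : K ^ 2 * (d + r + 1) ≤ K ^ 2 * ((d + 1) * (r + 1)) := by gcongr
    nlinarith
  rw [expMajorant, Finset.prod_range_succ, ← expMajorant, Nat.factorial_succ]
  have hf : (0 : ℝ) < r.factorial := by positivity
  push_cast at h1 ⊢
  rw [div_le_iff₀ (by positivity)]
  calc _ ≤ expMajorant K d r * ((r + 1) / 2) := by gcongr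
    _ = _ := by field_simp

theorem norm_powVec_le {n : ℕ} (g : Fin n ⊕ Fin n → ℂ) (l : Fin n → ℕ) {K : ℝ}
    (hK : ∑ c, ‖g c‖ ≤ K) (r : ℕ) : ‖powVec g l r‖ ≤ expMajorant K (∑ j, l j) r := by
  have hK0 : 0 ≤ K := (Finset.sum_nonneg fun _ _ => norm_nonneg _).trans hK
  induction r with
  | zero =>
    have : powVec g l 0 = fockBasis l := rfl
    rw [this, fockBasis, lp.norm_single (by norm_num)]
    simp [expMajorant]
  | succ r ih =>
    refine (norm_powVec_succ g l r).trans ?_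
    rw [expMajorant, Finset.prod_range_succ, ← expMajorant, mul_comm (expMajorant _ _ _)]
    gcongr

theorem norm_pow_apply_le {n : ℕ} (g : Fin n ⊕ Fin n → ℂ) (l : Fin n → ℕ) {K : ℝ}
    (hK : ∑ c, ‖g c‖ ≤ K) (r : ℕ) (k : Fin n → ℕ) :
    ‖(linForm g ^ r) (fockBasis l : FockSeq n) k‖ ≤ expMajorant K (∑ j, l j) r :=
  (lp.norm_apply_le_norm (by norm_num) (powVec g l r) k).trans (norm_powVec_le g l hK r)

theorem norm_linFormCLM_le {n : ℕ} {φ : FockSeq n} {b : ℝ} (h : ∀ k, ‖φ k‖ ≤ b) (k : Fin n → ℕ) :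
    ‖linFormCLM φ k‖ ≤ (∑ c, ‖ladderCoeff c k‖ * ‖boldCLM (n := n) c‖) * b := by
  rw [linFormCLM, Finset.sum_mul]
  refine (norm_sum_le _ _).trans (Finset.sum_le_sum fun c _ => ?_)
  rw [norm_smul, norm_mul, mul_right_comm]
  gcongr
  exact h _

theorem norm_symplCLM_le {n : ℕ} {z : Fin n → ℂ} {R : ℝ} (hz : ‖z‖ ≤ R) :
    ‖symplCLM z‖ ≤ R * ∑ j, (‖boldCLM (n := n) (Sum.inr j)‖ + ‖boldCLM (n := n) (Sum.inl j)‖) := by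
  rw [symplCLM, Finset.mul_sum]
  refine (norm_sum_le _ _).trans (Finset.sum_le_sum fun j _ => (norm_sub_le _ _).trans ?_)
  rw [norm_smul, norm_smul, mul_add, boldCLM_apply, boldCLM_apply]
  gcongr <;> exact norm_boldVec_le hz _

/-- The derivative of `z ↦ (e^{i 𝐳ᵀ 𝔞} φ)_k`, where `ψ = e^{i 𝐳ᵀ 𝔞} φ`. -/
def weylDeriv {n : ℕ} (ψ : FockSeq n) (z : Fin n → ℂ) (k : Fin n → ℕ) :
    (Fin n → ℂ) →L[ℝ] ℂ :=
  Complex.I • linFormCLM ψ k - (ψ k / 2) • symplCLM z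

/-- The factor r/r! shifts the series by one and leaves a factor i; r(r − 1)/(2 r!) shifts it by two
and leaves i²/2. This is the origin of the −½ in front of the commutator. -/
theorem hasSum_powDeriv {n : ℕ} {z : Fin n → ℂ} {φ ψ : FockSeq n}
    (h : ∀ k, HasSum (fun r : ℕ => Complex.I ^ r / (r.factorial : ℂ) *
      (linForm (boldVec z) ^ r) φ k) (ψ k)) (k : Fin n → ℕ) :
    HasSum (fun r : ℕ => (Complex.I ^ r / (r.factorial : ℂ)) • powDeriv φ z r k)
      (weylDeriv ψ z k) := by
  have h1 : HasSum (fun r : ℕ => (Complex.I ^ r / (r.factorial : ℂ)) • (r : ℂ) •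
      linFormCLM ((linForm (boldVec z) ^ (r - 1)) φ) k) (Complex.I • linFormCLM ψ k) := by
    have := (hasSum_sum (s := Finset.univ) fun c _ =>
      ((h (ladderShift c k)).mul_left (ladderCoeff c k)).smul_const
        (boldCLM (n := n) c)).const_smul Complex.I
    refine hasSum_of_nat_shift 1 this (fun r hr => ?_) fun r => ?_
    · obtain rfl : r = 0 := by omega
      ext w
      simp
    rw [smul_smul, linFormCLM, Finset.smul_sum, Finset.smul_sum]
    refine Finset.sum_congr rfl fun c _ => ?_
    rw [smul_smul, smul_smul, Nat.factorial_succ, pow_succ, add_tsub_cancel_right]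
    congr 1
    have : (r.factorial : ℂ) ≠ 0 := by exact_mod_cast Nat.factorial_ne_zero r
    have : (r + 1 : ℂ) ≠ 0 := by exact_mod_cast Nat.succ_ne_zero r
    push_cast
    field_simp
  have h2 : HasSum (fun r : ℕ => (Complex.I ^ r / (r.factorial : ℂ)) • ((r : ℂ) * (r - 1) / 2 *
      (linForm (boldVec z) ^ (r - 2)) φ k) • symplCLM z) ((-1 / 2 * ψ k) • symplCLM z) := by
    simp only [smul_smul]
    refine HasSum.smul_const ?_ _
    refine hasSum_of_nat_shift 2 ((h k).mul_left (-1 / 2)) (fun r hr => ?_) fun r => ?_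
    · interval_cases r <;> simp
    · rw [Nat.factorial_succ, Nat.factorial_succ, pow_add, Complex.I_sq, Nat.add_sub_cancel]
      have : (r.factorial : ℂ) ≠ 0 := by exact_mod_cast Nat.factorial_ne_zero r
      have : (r + 1 : ℂ) ≠ 0 := by exact_mod_cast Nat.succ_ne_zero r
      have : (r + 1 + 1 : ℂ) ≠ 0 := by exact_mod_cast Nat.succ_ne_zero (r + 1)
      push_cast
      field_simp
      ring
  have e : weylDeriv ψ z k = Complex.I • linFormCLM ψ k + (-1 / 2 * ψ k) • symplCLM z := by
    ext w
    simp only [weylDeriv, sub_apply, add_apply, smul_apply, smul_eq_mul]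
    ring
  rw [e]
  convert h1.add h2 using 2 with r
  rw [powDeriv, smul_add]

theorem hasFDerivAt_weyl {n : ℕ} (z : Fin n → ℂ) (l k : Fin n → ℕ) :
    HasFDerivAt (fun z => weyl z (fockBasis l) k)
      (weylDeriv (weyl z (fockBasis l) : FockSeq n) z k) z := by
  have h : ∀ z, HasSum (fun r : ℕ => Complex.I ^ r / (r.factorial : ℂ) *
      (linForm (boldVec z) ^ r) (fockBasis l : FockSeq n) k) (weyl z (fockBasis l) k) :=
    fun z => Pi.hasSum.1 (hasSum_fock_coe (weyl_fockBasis z l)) k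
  -- This bounds ‖y‖ for all y in the unit ball about z, where the differentiated series is
  -- dominated; K then bounds the sum of the 2n coefficient norms.
  set R : ℝ := ‖z‖ + 1
  have hR : 0 ≤ R := by positivity
  set K : ℝ := ∑ _c : Fin n ⊕ Fin n, R
  have hK : 0 ≤ K := Finset.sum_nonneg fun _ _ => hR
  set d := ∑ j, l j
  set A : ℝ := ∑ c, ‖ladderCoeff c k‖ * ‖boldCLM (n := n) c‖
  set S : ℝ := R * ∑ j, (‖boldCLM (n := n) (Sum.inr j)‖ + ‖boldCLM (n := n) (Sum.inl j)‖)
  have hA : 0 ≤ A := Finset.sum_nonneg fun _ _ => by positivity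
  have hS : 0 ≤ S := mul_nonneg hR (Finset.sum_nonneg fun _ _ => by positivity)
  have hsum := summable_expMajorant hK d
  have s1 : Summable fun r : ℕ => (r : ℝ) / r.factorial * expMajorant K d (r - 1) := by
    refine (summable_nat_add_iff 1).1 (hsum.congr fun r => ?_)
    rw [Nat.factorial_succ, add_tsub_cancel_right]
    push_cast
    field_simp
  have s2 : Summable fun r : ℕ => (r : ℝ) * (r - 1) / r.factorial * expMajorant K d (r - 2) := by
    refine (summable_nat_add_iff 2).1 (hsum.congr fun r => ?_)
    rw [Nat.factorial_succ, Nat.factorial_succ, Nat.add_sub_cancel]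
    push_cast
    field_simp
    ring
  have key := hasFDerivAt_tsum_of_isPreconnected (𝕜 := ℝ)
    (f := fun (r : ℕ) z => Complex.I ^ r / (r.factorial : ℂ) *
      (linForm (boldVec z) ^ r) (fockBasis l : FockSeq n) k)
    (f' := fun r z => (Complex.I ^ r / (r.factorial : ℂ)) •
      powDeriv (fockBasis l : FockSeq n) z r k)
    (u := fun r : ℕ => A * ((r : ℝ) / r.factorial * expMajorant K d (r - 1))
      + S / 2 * ((r : ℝ) * (r - 1) / r.factorial * expMajorant K d (r - 2)))
    (s := Metric.ball z 1) (x₀ := z) (x := z)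
    ((s1.mul_left A).add (s2.mul_left (S / 2))) Metric.isOpen_ball
    (convex_ball z 1).isPreconnected
    (fun r y _ => (hasFDerivAt_linForm_pow _ y r k).const_mul _) ?_
    (Metric.mem_ball_self one_pos) (h z).summable (Metric.mem_ball_self one_pos)
  · have hd := hasSum_powDeriv (φ := (fockBasis l : FockSeq n))
      (ψ := (weyl z (fockBasis l) : FockSeq n))
      (fun k => Pi.hasSum.1 (hasSum_fock_coe (weyl_fockBasis z l)) k) k
    rw [hd.tsum_eq] at key
    refine key.congr_of_eventuallyEq (Filter.Eventually.of_forall fun y => ?_)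
    exact (h y).tsum_eq.symm
  · intro r y hy
    have hy' : ‖y‖ ≤ R := by
      have h1 : ‖y - z‖ < 1 := by simpa [dist_eq_norm] using hy
      have h2 := norm_add_le (y - z) z
      rw [sub_add_cancel] at h2
      simp only [R]
      linarith
    have hyK : ∑ c, ‖boldVec y c‖ ≤ K := Finset.sum_le_sum fun c _ => norm_boldVec_le hy' c
    have b1 := norm_linFormCLM_le (norm_pow_apply_le (boldVec y) l hyK (r - 1)) k
    have b2 := norm_pow_apply_le (boldVec y) l hyK (r - 2) k
    have b3 := norm_symplCLM_le hy'
    have hr : ‖(r : ℂ) * (r - 1) / 2‖ = (r : ℝ) * (r - 1) / 2 := by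
      rcases r with _ | r
      · simp
      · push_cast
        simp only [add_sub_cancel_right]
        norm_num
        left
        exact_mod_cast Complex.norm_natCast (r + 1)
    have hr0 : 0 ≤ (r : ℝ) * (r - 1) / 2 := hr ▸ norm_nonneg _
    have hM := expMajorant_nonneg hK d (r - 1)
    have hM' := expMajorant_nonneg hK d (r - 2)
    have hc : ‖Complex.I ^ r / (r.factorial : ℂ)‖ = 1 / r.factorial := by simp
    rw [norm_smul, hc, powDeriv]
    have b4 : ‖(r : ℂ) • linFormCLM ((linForm (boldVec y) ^ (r - 1)) (fockBasis l : FockSeq n)) k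
        + ((r : ℂ) * (r - 1) / 2 * (linForm (boldVec y) ^ (r - 2)) (fockBasis l : FockSeq n) k) •
          symplCLM y‖ ≤ r * (A * expMajorant K d (r - 1))
            + (r : ℝ) * (r - 1) / 2 * expMajorant K d (r - 2) * S := by
      refine (norm_add_le _ _).trans ?_
      rw [norm_smul, norm_smul, norm_mul, hr, Complex.norm_natCast]
      gcongr
    exact (mul_le_mul_of_nonneg_left b4 (by positivity)).trans (le_of_eq (by ring))

/-! ### Derivatives of products of linear forms applied to the Weyl operator -/

/-- The real linear map `w ↦ i ∑_c a_c 𝐰_c - b/2 [𝐳ᵀ 𝔞, 𝐰ᵀ 𝔞]`. -/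
def formDeriv {n : ℕ} (a : Fin n ⊕ Fin n → ℂ) (b : ℂ) (z : Fin n → ℂ) : (Fin n → ℂ) →L[ℝ] ℂ :=
  ∑ c, (Complex.I * a c) • boldCLM c - (b / 2) • symplCLM z

theorem formDeriv_apply {n : ℕ} (a : Fin n ⊕ Fin n → ℂ) (b : ℂ) (z w : Fin n → ℂ) :
    formDeriv a b z w = Complex.I * ∑ c, boldVec w c * a c
      - b / 2 * sympl (boldVec z) (boldVec w) := by
  simp only [formDeriv, sub_apply, sum_apply, smul_apply, boldCLM_apply, symplCLM_apply,
    smul_eq_mul, Finset.mul_sum]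
  congr 1
  exact Finset.sum_congr rfl fun c _ => by ring

theorem linForm_single {n : ℕ} (c : Fin n ⊕ Fin n) (φ : FockSeq n) :
    linForm (Pi.single c 1) φ = ladder c φ := by
  rw [linForm_eq_sum, Finset.sum_eq_single c]
  · simp
  · intro d _ hd
    simp [hd]
  · simp

theorem linProd_concat_eq_sum {n : ℕ} (gs : List (Fin n ⊕ Fin n → ℂ)) (g : Fin n ⊕ Fin n → ℂ)
    (φ : FockSeq n) (k : Fin n → ℕ) :
    linProd (gs ++ [g]) φ k = ∑ c, g c * linProd (gs ++ [Pi.single c 1]) φ k := by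
  simp only [linProd_concat, linForm_single]
  rw [linForm_eq_sum, map_sum, Finset.sum_apply]
  simp

/-- The derivative of `z ↦ (g_1ᵀ 𝔞 ⋯ g_mᵀ 𝔞 e^{i 𝐳ᵀ 𝔞} φ)_k`, where `ψ = e^{i 𝐳ᵀ 𝔞} φ`. -/
def linProdDeriv {n : ℕ} (gs : List (Fin n ⊕ Fin n → ℂ)) (ψ : FockSeq n) (z : Fin n → ℂ)
    (k : Fin n → ℕ) : (Fin n → ℂ) →L[ℝ] ℂ :=
  formDeriv (fun c => linProd (gs ++ [Pi.single c 1]) ψ k) (linProd gs ψ k) z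

theorem linProdDeriv_apply {n : ℕ} (gs : List (Fin n ⊕ Fin n → ℂ)) (ψ : FockSeq n)
    (z w : Fin n → ℂ) (k : Fin n → ℕ) : linProdDeriv gs ψ z k w
      = linProd gs (Complex.I • linForm (boldVec w) ψ
          - (sympl (boldVec z) (boldVec w) / 2) • ψ) k := by
  rw [linProdDeriv, formDeriv_apply, ← linProd_concat_eq_sum, linProd_concat, map_sub, map_smul,
    map_smul]
  simp only [Pi.sub_apply, Pi.smul_apply, smul_eq_mul]
  ring

/-- Each coordinate of a product of forms is a finite combination of coordinates, so differentiation
commutes with the product. The new form therefore enters at its right end, next to the Weyl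
operator. -/
theorem hasFDerivAt_linProd_weyl {n : ℕ} (gs : List (Fin n ⊕ Fin n → ℂ)) (z : Fin n → ℂ)
    (l k : Fin n → ℕ) :
    HasFDerivAt (fun z => linProd gs (weyl z (fockBasis l) : FockSeq n) k)
      (linProdDeriv gs (weyl z (fockBasis l) : FockSeq n) z k) z := by
  induction gs generalizing k with
  | nil =>
    refine (hasFDerivAt_weyl z l k).congr_fderiv ?_
    ext w
    rw [linProdDeriv_apply, linProd_nil]
    simp only [weylDeriv, sub_apply, smul_apply, linFormCLM_apply, symplCLM_apply, Pi.sub_apply,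
      Pi.smul_apply, smul_eq_mul]
    ring
  | cons g gs ih =>
    simp only [linProd_cons, linForm_apply]
    have h2 := HasFDerivAt.fun_sum (u := Finset.univ) fun c _ =>
      ((ih (ladderShift c k)).const_mul (ladderCoeff c k)).const_mul (g c)
    refine h2.congr_fderiv ?_
    ext w
    rw [linProdDeriv_apply, linProd_cons, linForm_apply, sum_apply]
    simp only [smul_apply, linProdDeriv_apply, smul_eq_mul]

/-! ### The form bound -/

/-- The form weight `(1 + |k|)^{m/2}`. -/
def occWeight {n : ℕ} (m : ℕ) (k : Fin n → ℕ) : ℝ := √((1 + ∑ j, (k j : ℝ)) ^ m)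

theorem occWeight_pos {n : ℕ} (m : ℕ) (k : Fin n → ℕ) : 0 < occWeight m k :=
  Real.sqrt_pos.2 (by positivity)

theorem occWeight_sq {n : ℕ} (m : ℕ) (k : Fin n → ℕ) :
    occWeight m k ^ 2 = (1 + ∑ j, (k j : ℝ)) ^ m := Real.sq_sqrt (by positivity)

/-- The finite combination of basis vectors with coefficients `v` on `s`. -/
def finVec {n : ℕ} (s : Finset (Fin n → ℕ)) (v : FockSeq n) : Fock n := ∑ l ∈ s, v l • fockBasis l

theorem finVec_apply {n : ℕ} (s : Finset (Fin n → ℕ)) (v : FockSeq n) (k : Fin n → ℕ) :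
    finVec s v k = if k ∈ s then v k else 0 := by
  rw [finVec, lp.coeFn_sum, Finset.sum_apply, ← Finset.sum_ite_eq s k v]
  refine Finset.sum_congr rfl fun l _ => ?_
  rw [lp.coeFn_smul, Pi.smul_apply, fockBasis, lp.single_apply, smul_eq_mul]
  rcases eq_or_ne k l with rfl | h
  · simp
  · simp [h]

theorem finDeg_finVec {n : ℕ} (s : Finset (Fin n → ℕ)) (v : FockSeq n) :
    FinDeg (∑ l ∈ s, ∑ j, l j) (finVec s v : FockSeq n) := by
  intro k hk
  change finVec s v k = 0
  rw [finVec_apply, if_neg]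
  intro hks
  have := Finset.single_le_sum (f := fun l : Fin n → ℕ => ∑ j, l j) (fun _ _ => Nat.zero_le _) hks
  exact absurd hk (not_lt.2 this)

theorem wnorm_finVec {n : ℕ} (m : ℕ) (s : Finset (Fin n → ℕ)) (v : FockSeq n) :
    wnorm m (finVec s v : FockSeq n)
      = ENNReal.ofReal (∑ k ∈ s, occWeight m k ^ 2 * ‖v k‖ ^ 2) := by
  rw [wnorm, tsum_eq_sum (s := s), ENNReal.ofReal_sum_of_nonneg fun k _ => by positivity]
  · refine Finset.sum_congr rfl fun k hk => ?_
    rw [finVec_apply, if_pos hk, occWeight_sq, ENNReal.ofReal_mul (by positivity),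
      ENNReal.ofReal_pow (by positivity), ENNReal.ofReal_pow (by positivity), ofReal_norm]
    congr 2
    rw [← ENNReal.ofReal_natCast]
    push_cast
    rfl
  · intro k hk
    rw [finVec_apply, if_neg hk]
    simp

theorem wnorm_zero_coe {n : ℕ} (u : Fock n) :
    wnorm 0 (u : FockSeq n) = ENNReal.ofReal (‖u‖ ^ 2) := by
  have h := lp.hasSum_norm (p := 2) (by norm_num) u
  simp only [ENNReal.toReal_ofNat, Real.rpow_ofNat] at h
  rw [← h.tsum_eq, ENNReal.ofReal_tsum_of_nonneg (fun _ => by positivity) h.summable, wnorm]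
  refine tsum_congr fun k => ?_
  rw [pow_zero, one_mul, ENNReal.ofReal_pow (by positivity), ofReal_norm]

theorem norm_weyl {n : ℕ} (z : Fin n → ℂ) (u : Fock n) : ‖weyl z u‖ = ‖u‖ :=
  LinearIsometry.norm_map _ u

theorem weyl_fockBasis_eq {n : ℕ} (z : Fin n → ℂ) (l : Fin n → ℕ) :
    weyl z (fockBasis l) = expVec z l := by
  simp [weyl, fockBasis]

theorem linProd_weyl_finVec {n : ℕ} (gs : List (Fin n ⊕ Fin n → ℂ)) (z : Fin n → ℂ)
    (s : Finset (Fin n → ℕ)) (v : FockSeq n) (k : Fin n → ℕ) :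
    linProd gs (weyl z (finVec s v) : FockSeq n) k
      = ∑ l ∈ s, linProd gs (weyl z (fockBasis l) : FockSeq n) k * v l := by
  have : (weyl z (finVec s v) : FockSeq n)
      = ∑ l ∈ s, v l • (weyl z (fockBasis l) : FockSeq n) := by
    rw [finVec, map_sum, lp.coeFn_sum]
    simp
  rw [this, map_sum, Finset.sum_apply]
  refine Finset.sum_congr rfl fun l _ => ?_
  rw [map_smul, Pi.smul_apply, smul_eq_mul, mul_comm]

theorem sum_norm_sq_le_of_wnorm_le {n m : ℕ} {C : NNReal} {D : ℝ} (hD : (C : ℝ) ≤ D ^ 2)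
    {s : Finset (Fin n → ℕ)} {v : FockSeq n} {y : Fock n}
    (h : wnorm 0 (y : FockSeq n) ≤ C * wnorm m (finVec s v : FockSeq n)) :
    ‖y‖ ^ 2 ≤ D ^ 2 * ∑ k ∈ s, occWeight m k ^ 2 * ‖v k‖ ^ 2 := by
  have hnn : 0 ≤ ∑ k ∈ s, occWeight m k ^ 2 * ‖v k‖ ^ 2 :=
    Finset.sum_nonneg fun _ _ => by positivity
  rw [wnorm_zero_coe, wnorm_finVec, ← ENNReal.ofReal_coe_nnreal,
    ← ENNReal.ofReal_mul C.coe_nonneg, ENNReal.ofReal_le_ofReal_iff (mul_nonneg C.coe_nonneg hnn)] at h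
  exact h.trans (mul_le_mul_of_nonneg_right hD hnn)

theorem pairing_finVec {n : ℕ} (s : Finset (Fin n → ℕ)) (u φ : FockSeq n) :
    pairing (finVec s u : FockSeq n) φ = ∑ k ∈ s, u k * φ k := by
  rw [pairing, tsum_eq_sum (s := s)]
  · exact Finset.sum_congr rfl fun k hk => by rw [finVec_apply, if_pos hk]
  · intro k hk
    rw [finVec_apply, if_neg hk, zero_mul]

theorem FinDeg.exists_conj {n M : ℕ} {u : FockSeq n} (hu : FinDeg M u) :
    ∃ y : Fock n, (∀ x : Fock n, ‖inner ℂ x y‖ = ‖pairing u (x : FockSeq n)‖) ∧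
      ∀ p, wnorm p (y : FockSeq n) = wnorm p u := by
  have hy : ∀ k, finVec hu.finite_support.toFinset (fun k => star (u k)) k = star (u k) := by
    intro k
    rw [finVec_apply]
    split_ifs with h
    · rfl
    · rw [Set.Finite.mem_toFinset, Function.mem_support, not_not] at h
      rw [h, star_zero]
  refine ⟨finVec hu.finite_support.toFinset fun k => star (u k), fun x => ?_, fun p => ?_⟩
  · rw [norm_inner_symm, lp.inner_eq_tsum, pairing]
    congr 1
    refine tsum_congr fun k => ?_
    rw [hy]
    simp [mul_comm]
  · rw [wnorm, wnorm]
    refine tsum_congr fun k => ?_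
    rw [hy]
    simp [enorm]

/-- For the bound on columns the forms are moved to the right of the Weyl operator, which is
isometric. For the bound on rows they are transposed onto u, and Bessel's inequality for the
orthonormal images of the basis vectors finishes. -/
theorem bilinBound_linProd_weyl {n : ℕ} (gs : List (Fin n ⊕ Fin n → ℂ)) {m : ℕ}
    (hm : gs.length ≤ m) (R : ℝ) :
    ∃ D : ℝ, 0 ≤ D ∧ ∀ z : Fin n → ℂ, ‖z‖ ≤ R →
      BilinBound (fun k l => linProd gs (weyl z (fockBasis l) : FockSeq n) k) (occWeight m) D := by
  obtain ⟨C₁, hC₁⟩ := exists_linProd_weyl gs R 0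
  obtain ⟨C₂, hC₂⟩ := exists_transpose gs 0
  have hsq : √((C₁ : ℝ) + C₂) ^ 2 = C₁ + C₂ := Real.sq_sqrt (by positivity)
  -- `C₁` and `C₂` bound squared norms, whence the root; their sum serves both directions.
  refine ⟨√(C₁ + C₂), Real.sqrt_nonneg _, fun z hz => ?_⟩
  refine BilinBound.of_weights (occWeight_pos m) (Real.sqrt_nonneg _) (fun s v => ?_) fun s u => ?_
  · obtain ⟨M', y, -, h2, h3⟩ := hC₁ z hz _ _ (finDeg_finVec s v)
    have h4 := sum_norm_sq_le_of_wnorm_le (m := m) (D := √(C₁ + C₂))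
      (by rw [hsq]; exact le_add_of_nonneg_right C₂.2)
      (h3.trans (mul_le_mul_right (wnorm_mono (by omega) _) _))
    refine le_trans ?_ h4
    rw [← norm_weyl z y]
    refine le_trans (le_of_eq ?_) (sum_sq_le_norm_sq (weyl z y) s)
    refine Finset.sum_congr rfl fun k _ => ?_
    rw [← linProd_weyl_finVec, h2]
  · obtain ⟨M', u', h1, h2, h3⟩ := hC₂ _ _ (finDeg_finVec s u)
    obtain ⟨y, hy1, hy2⟩ := h1.exists_conj
    have h4 := sum_norm_sq_le_of_wnorm_le (m := m) (D := √(C₁ + C₂)) (y := y)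
      (by rw [hsq]; exact le_add_of_nonneg_left C₁.2)
      (((hy2 0).trans_le h3).trans (mul_le_mul_right (wnorm_mono (by omega) _) _))
    refine le_trans (le_of_eq ?_) ((Orthonormal.sum_inner_products_le y (orthonormal_expVec z)
      (s := s)).trans h4)
    refine Finset.sum_congr rfl fun l _ => ?_
    rw [← pairing_finVec, h2, hy1, weyl_fockBasis_eq]

/-! ### States -/

open scoped ComplexOrder in
theorem posKernel_of_isPositive {n : ℕ} {ρ : Fock n →L[ℂ] Fock n} (hρ : ρ.IsPositive) :
    PosKernel fun k l => ρ (fockBasis l) k := by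
  intro s
  refine Matrix.PosSemidef.of_dotProduct_mulVec_nonneg ?_ fun x => ?_
  · ext k l
    simp only [Matrix.conjTranspose_apply, Matrix.of_apply]
    rw [← inner_fockBasis, ← inner_fockBasis, Complex.star_def, inner_conj_symm]
    exact hρ.1 _ _
  · have h := hρ.inner_nonneg_right (∑ k : s, x k • fockBasis (k : Fin n → ℕ))
    refine h.trans_eq ?_
    rw [sum_inner, dotProduct]
    refine Finset.sum_congr rfl fun k _ => ?_
    rw [inner_smul_left, map_sum, inner_sum, Matrix.mulVec, dotProduct, Pi.star_apply,
      Complex.star_def]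
    congr 1
    refine Finset.sum_congr rfl fun l _ => ?_
    rw [map_smul, inner_smul_right, inner_fockBasis, Matrix.of_apply, mul_comm]

/-- The weight (1 + |k|)^{m/2} is at most a constant times 1 + |k|^{m/2}; the trace takes care of
the first summand and the moment of the second. -/
theorem summable_occWeight {n : ℕ} {ρ : Fock n →L[ℂ] Fock n} (hρ : IsDensity ρ) {m : ℕ}
    (hm : HasMoments ρ m) : Summable fun k => occWeight m k * (ρ (fockBasis k) k).re := by
  have h1 : Summable fun k : Fin n → ℕ => (ρ (fockBasis k) k).re := by
    have := Complex.reCLM.summable hρ.2.summable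
    simp only [inner_fockBasis] at this
    exact this
  simp only [HasMoments, inner_fockBasis] at hm
  have hnn : ∀ k, 0 ≤ (ρ (fockBasis k) k).re := (posKernel_of_isPositive hρ.1).re_nonneg
  refine Summable.of_nonneg_of_le (fun k => mul_nonneg (occWeight_pos m k).le (hnn k)) (fun k => ?_)
    ((h1.add hm).mul_left √(2 ^ (m - 1)))
  have hx : 0 ≤ ∑ j, (k j : ℝ) := by positivity
  have h2 : occWeight m k ≤ √(2 ^ (m - 1)) * (1 + (∑ j, (k j : ℝ)) ^ ((m : ℝ) / 2)) := by
    have e : (∑ j, (k j : ℝ)) ^ ((m : ℝ) / 2) = √((∑ j, (k j : ℝ)) ^ m) := by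
      rw [Real.sqrt_eq_rpow, ← Real.rpow_natCast, ← Real.rpow_mul hx]
      congr 1
      ring
    have h3 := add_pow_le zero_le_one hx m
    rw [one_pow] at h3
    rw [e, occWeight]
    refine (Real.sqrt_le_sqrt h3).trans ?_
    rw [Real.sqrt_mul (by positivity)]
    gcongr
    refine (Real.sqrt_le_left (by positivity)).2 ?_
    rw [add_sq, Real.sq_sqrt (by positivity)]
    nlinarith [Real.sqrt_nonneg ((∑ j, (k j : ℝ)) ^ m)]
  calc _ ≤ √(2 ^ (m - 1)) * (1 + (∑ j, (k j : ℝ)) ^ ((m : ℝ) / 2)) * (ρ (fockBasis k) k).re :=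
        mul_le_mul_of_nonneg_right h2 (hnn k)
    _ = _ := by ring

/-! ### Moments of `e^{i 𝐳ᵀ 𝔞} ρ` -/

/-- The trace `tr (g_1ᵀ 𝔞 ⋯ g_mᵀ 𝔞 e^{i 𝐳ᵀ 𝔞} ρ)`. -/
def weylMoment {n : ℕ} (ρ : Fock n →L[ℂ] Fock n) (gs : List (Fin n ⊕ Fin n → ℂ))
    (z : Fin n → ℂ) : ℂ :=
  ∑' k, linProd gs (weyl z (ρ (fockBasis k)) : FockSeq n) k

/-- The trace of `g_1ᵀ 𝔞 ⋯ g_mᵀ 𝔞 e^{i 𝐳ᵀ 𝔞}` against the compression of `ρ` to the span of the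
`e_k`, `k ∈ s`. -/
def truncMoment {n : ℕ} (ρ : Fock n →L[ℂ] Fock n) (s : Finset (Fin n → ℕ))
    (gs : List (Fin n ⊕ Fin n → ℂ)) (z : Fin n → ℂ) : ℂ :=
  ∑ k ∈ s, ∑ l ∈ s, linProd gs (weyl z (fockBasis l) : FockSeq n) k * ρ (fockBasis k) l

theorem hasSum_linProd_weyl {n : ℕ} (ρ : Fock n →L[ℂ] Fock n) (gs : List (Fin n ⊕ Fin n → ℂ))
    (z : Fin n → ℂ) (k : Fin n → ℕ) :
    HasSum (fun l => linProd gs (weyl z (fockBasis l) : FockSeq n) k * ρ (fockBasis k) l)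
      (linProd gs (weyl z (ρ (fockBasis k)) : FockSeq n) k) := by
  have h := hasSum_fock_coe ((hasSum_fockBasis (ρ (fockBasis k))).mapL (weyl z))
  have h2 := Pi.hasSum.1 (h.map (linProd gs) (continuous_linProd gs)) k
  convert h2 using 2 with l
  rw [Function.comp_apply, map_smul, lp.coeFn_smul, map_smul, Pi.smul_apply, smul_eq_mul, mul_comm]

/-- The error of the truncation to `s`, up to a constant. -/
def truncError {n : ℕ} (ρ : Fock n →L[ℂ] Fock n) (m : ℕ) (s : Finset (Fin n → ℕ)) : ℝ :=
  √(∑' k, occWeight m k * (ρ (fockBasis k) k).re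
    - ∑ k ∈ s, occWeight m k * (ρ (fockBasis k) k).re)

section

variable {n : ℕ} {ρ : Fock n →L[ℂ] Fock n} {m : ℕ}

theorem tendsto_truncError (hρ : IsDensity ρ) (hm : HasMoments ρ m) :
    Filter.Tendsto (truncError ρ m) Filter.atTop (nhds 0) := by
  have h := (((summable_occWeight hρ hm).hasSum.const_sub
    (∑' k, occWeight m k * (ρ (fockBasis k) k).re)).sqrt)
  simp only [sub_self, Real.sqrt_zero] at h
  exact h

/-- The error factor does not involve z, and the constant depends on z only through the bound R;
this is the source of all uniform convergence below. -/
theorem exists_truncMoment_bound (hρ : IsDensity ρ) (hm : HasMoments ρ m)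
    {gs : List (Fin n ⊕ Fin n → ℂ)} (hgs : gs.length ≤ m) (R : ℝ) :
    ∃ D : ℝ, ∀ z : Fin n → ℂ, ‖z‖ ≤ R →
      Summable (fun k => linProd gs (weyl z (ρ (fockBasis k)) : FockSeq n) k) ∧
      ∀ s, ‖weylMoment ρ gs z - truncMoment ρ s gs z‖ ≤ D * truncError ρ m s := by
  classical
  obtain ⟨C, hC, h⟩ := bilinBound_linProd_weyl gs hgs R
  exact ⟨_, fun z hz => (h z hz).trace (occWeight_pos m) hC (posKernel_of_isPositive hρ.1)
    (summable_occWeight hρ hm) (hasSum_linProd_weyl ρ gs z)⟩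

theorem summable_linProd_weyl (hρ : IsDensity ρ) (hm : HasMoments ρ m)
    {gs : List (Fin n ⊕ Fin n → ℂ)} (hgs : gs.length ≤ m) (z : Fin n → ℂ) :
    Summable fun k => linProd gs (weyl z (ρ (fockBasis k)) : FockSeq n) k :=
  ((exists_truncMoment_bound hρ hm hgs ‖z‖).choose_spec z le_rfl).1

theorem tendstoUniformlyOn_of_norm_sub_le {α ι E : Type*} [SeminormedAddCommGroup E] {l : Filter ι}
    {f : ι → α → E} {g : α → E} {S : Set α} {τ : ι → ℝ} (hτ : Filter.Tendsto τ l (nhds 0))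
    (h : ∃ D : ℝ, ∀ x ∈ S, ∀ i, ‖g x - f i x‖ ≤ D * τ i) : TendstoUniformlyOn f g l S := by
  obtain ⟨D, hD⟩ := h
  rw [Metric.tendstoUniformlyOn_iff]
  intro ε hε
  have h2 : Filter.Tendsto (fun i => D * τ i) l (nhds 0) := by simpa using hτ.const_mul D
  filter_upwards [h2.eventually (gt_mem_nhds hε)] with i hi x hx
  rw [dist_eq_norm]
  exact (hD x hx i).trans_lt hi

theorem tendstoUniformlyOn_truncMoment (hρ : IsDensity ρ) (hm : HasMoments ρ m)
    {gs : List (Fin n ⊕ Fin n → ℂ)} (hgs : gs.length ≤ m) (R : ℝ) :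
    TendstoUniformlyOn (fun s => truncMoment ρ s gs) (weylMoment ρ gs) Filter.atTop
      (Metric.ball 0 R) := by
  obtain ⟨D, hD⟩ := exists_truncMoment_bound hρ hm hgs R
  exact tendstoUniformlyOn_of_norm_sub_le (tendsto_truncError hρ hm)
    ⟨D, fun z hz => (hD z (by simpa using (Metric.mem_ball.1 hz).le)).2⟩

theorem hasFDerivAt_truncMoment (s : Finset (Fin n → ℕ)) (gs : List (Fin n ⊕ Fin n → ℂ))
    (z : Fin n → ℂ) :
    HasFDerivAt (truncMoment ρ s gs)
      (formDeriv (fun c => truncMoment ρ s (gs ++ [Pi.single c 1]) z) (truncMoment ρ s gs z) z)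
      z := by
  have h := HasFDerivAt.fun_sum (u := s) fun k _ => HasFDerivAt.fun_sum (u := s) fun l _ =>
    (hasFDerivAt_linProd_weyl gs z l k).mul_const (ρ (fockBasis k) l)
  refine h.congr_fderiv ?_
  ext w
  simp only [sum_apply, smul_apply, linProdDeriv, formDeriv_apply, truncMoment, smul_eq_mul,
    Finset.mul_sum, Finset.sum_div, Finset.sum_mul, mul_sub, Finset.sum_sub_distrib]
  congr 1
  · rw [Finset.sum_comm (s := Finset.univ)]
    refine Finset.sum_congr rfl fun k _ => ?_
    rw [Finset.sum_comm (s := Finset.univ)]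
    refine Finset.sum_congr rfl fun l _ => Finset.sum_congr rfl fun c _ => ?_
    ring
  · refine Finset.sum_congr rfl fun k _ => Finset.sum_congr rfl fun l _ => ?_
    ring

theorem norm_formDeriv_sub_le (a a' : Fin n ⊕ Fin n → ℂ) (b b' : ℂ) {z : Fin n → ℂ} {R : ℝ}
    (hz : ‖z‖ ≤ R) : ‖formDeriv a b z - formDeriv a' b' z‖
      ≤ ∑ c, ‖a c - a' c‖ * ‖boldCLM (n := n) c‖ + ‖b - b'‖ *
        (R * ∑ j, (‖boldCLM (n := n) (Sum.inr j)‖ + ‖boldCLM (n := n) (Sum.inl j)‖)) := by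
  have e : formDeriv a b z - formDeriv a' b' z
      = ∑ c, (Complex.I * (a c - a' c)) • boldCLM c - ((b - b') / 2) • symplCLM z := by
    ext w
    simp only [formDeriv, sub_apply, sum_apply, smul_apply, smul_eq_mul, mul_sub, sub_mul,
      Finset.sum_sub_distrib, sub_div]
    ring
  rw [e]
  refine (norm_sub_le _ _).trans (add_le_add ((norm_sum_le _ _).trans ?_) ?_)
  · refine Finset.sum_le_sum fun c _ => ?_
    rw [norm_smul, norm_mul, Complex.norm_I, one_mul]
  · rw [norm_smul, norm_div]
    have := norm_symplCLM_le hz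
    gcongr
    simp only [Complex.norm_ofNat]
    linarith [norm_nonneg (b - b')]

theorem tendstoUniformlyOn_formDeriv (hρ : IsDensity ρ) (hm : HasMoments ρ m)
    {gs : List (Fin n ⊕ Fin n → ℂ)} (hgs : gs.length < m) (R : ℝ) :
    TendstoUniformlyOn
      (fun s z => formDeriv (fun c => truncMoment ρ s (gs ++ [Pi.single c 1]) z)
        (truncMoment ρ s gs z) z)
      (fun z => formDeriv (fun c => weylMoment ρ (gs ++ [Pi.single c 1]) z) (weylMoment ρ gs z) z)
      Filter.atTop (Metric.ball 0 R) := by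
  refine tendstoUniformlyOn_of_norm_sub_le (tendsto_truncError hρ hm) ?_
  obtain ⟨D, hD⟩ := exists_truncMoment_bound hρ hm hgs.le R
  choose E hE using fun c : Fin n ⊕ Fin n => exists_truncMoment_bound hρ hm
    (gs := gs ++ [Pi.single c 1]) (by simpa using hgs) R
  refine ⟨∑ c, E c * ‖boldCLM (n := n) c‖ + D * (R *
    ∑ j, (‖boldCLM (n := n) (Sum.inr j)‖ + ‖boldCLM (n := n) (Sum.inl j)‖)), fun y hy s => ?_⟩
  have hy' : ‖y‖ ≤ R := by simpa using (Metric.mem_ball.1 hy).le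
  have hR : 0 ≤ R := (norm_nonneg y).trans hy'
  refine (norm_formDeriv_sub_le _ _ _ _ hy').trans ?_
  rw [add_mul, Finset.sum_mul, mul_right_comm D]
  refine add_le_add (Finset.sum_le_sum fun c _ => ?_)
    (mul_le_mul_of_nonneg_right ((hD y hy').2 s) (by positivity))
  rw [mul_right_comm]
  exact mul_le_mul_of_nonneg_right ((hE c y hy').2 s) (norm_nonneg _)

/-- The truncated moments converge, and their derivatives converge uniformly on balls. The
derivatives involve one form more, which is why the length has to be strictly below m. -/
theorem hasFDerivAt_weylMoment (hρ : IsDensity ρ) (hm : HasMoments ρ m)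
    {gs : List (Fin n ⊕ Fin n → ℂ)} (hgs : gs.length < m) (z : Fin n → ℂ) :
    HasFDerivAt (weylMoment ρ gs)
      (formDeriv (fun c => weylMoment ρ (gs ++ [Pi.single c 1]) z) (weylMoment ρ gs z) z) z := by
  have hz : z ∈ Metric.ball (0 : Fin n → ℂ) (‖z‖ + 1) := by simp
  have h1 := tendstoUniformlyOn_formDeriv hρ hm hgs (‖z‖ + 1)
  have h2 := fun (s : Finset (Fin n → ℕ)) (y : Fin n → ℂ)
    (_ : y ∈ Metric.ball (0 : Fin n → ℂ) (‖z‖ + 1)) => hasFDerivAt_truncMoment (ρ := ρ) s gs y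
  have h3 := fun (y : Fin n → ℂ) (hy : y ∈ Metric.ball 0 (‖z‖ + 1)) =>
    (tendstoUniformlyOn_truncMoment hρ hm hgs.le (‖z‖ + 1)).tendsto_at hy
  have h4 := hasFDerivAt_of_tendstoUniformlyOn Metric.isOpen_ball h1 h2 h3 hz
  exact h4

theorem continuous_weylMoment (hρ : IsDensity ρ) (hm : HasMoments ρ m)
    {gs : List (Fin n ⊕ Fin n → ℂ)} (hgs : gs.length ≤ m) : Continuous (weylMoment ρ gs) := by
  rw [continuous_iff_continuousAt]
  intro z
  have h := (tendstoUniformlyOn_truncMoment hρ hm hgs (‖z‖ + 1)).continuousOn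
    (Filter.Frequently.of_forall fun s y _ =>
      (hasFDerivAt_truncMoment s gs y).continuousAt.continuousWithinAt)
  exact h.continuousAt (Metric.isOpen_ball.mem_nhds (by simp))

theorem contDiff_symplCLM : ContDiff ℝ ⊤ (symplCLM (n := n)) := by
  unfold symplCLM
  fun_prop

theorem contDiff_weylMoment (hρ : IsDensity ρ) (hm : HasMoments ρ m) (r : ℕ)
    {gs : List (Fin n ⊕ Fin n → ℂ)} (hgs : gs.length + r ≤ m) :
    ContDiff ℝ r (weylMoment ρ gs) := by
  induction r generalizing gs with
  | zero => exact contDiff_zero.2 (continuous_weylMoment hρ hm hgs)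
  | succ r ih =>
    push_cast
    rw [contDiff_succ_iff_hasFDerivAt]
    -- The derivative is built from moments and a smooth function of z, so one order of smoothness
    -- is traded for one more linear form.
    refine ⟨_, ?_, hasFDerivAt_weylMoment hρ hm (by omega)⟩
    have h1 : ContDiff ℝ r (weylMoment ρ gs) := ih (by omega)
    have h2 : ∀ c, ContDiff ℝ r (weylMoment ρ (gs ++ [Pi.single c 1])) := fun c =>
      ih (by simp; omega)
    have h3 : ContDiff ℝ r (symplCLM (n := n)) := contDiff_symplCLM.of_le le_top
    unfold formDeriv
    fun_prop

theorem weylMoment_concat (hρ : IsDensity ρ) (hm : HasMoments ρ m)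
    {gs : List (Fin n ⊕ Fin n → ℂ)} (hgs : gs.length < m) (g : Fin n ⊕ Fin n → ℂ)
    (z : Fin n → ℂ) :
    weylMoment ρ (gs ++ [g]) z = ∑ c, g c * weylMoment ρ (gs ++ [Pi.single c 1]) z := by
  simp only [weylMoment, ← tsum_mul_left]
  rw [← Summable.tsum_finsetSum]
  · exact tsum_congr fun k => linProd_concat_eq_sum _ _ _ _
  · exact fun c _ => (summable_linProd_weyl hρ hm (by simpa using hgs) z).mul_left _

/-! ### The differential operators acting on moments -/

/-- The Wirtinger derivatives of a function whose real derivative is `formDeriv a b z`. -/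
theorem wirtinger_of_hasFDerivAt {f : (Fin n → ℂ) → ℂ} {a : Fin n ⊕ Fin n → ℂ} {b : ℂ}
    {z : Fin n → ℂ} (h : HasFDerivAt f (formDeriv a b z) z) (c : Fin n ⊕ Fin n) :
    Complex.I⁻¹ * wirtinger c f z
      - 1 / 2 * (Matrix.J (Fin n) ℂ).mulVec (Complex.I • boldVec z) c * b = a c := by
  have b1 : ∀ (j i : Fin n) (x : ℂ),
      boldVec (Pi.single j x) (Sum.inl i) = if i = j then x else 0 := fun j i x => by
    simp [boldVec, Pi.single_apply]
  have b2 : ∀ (j i : Fin n) (x : ℂ),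
      boldVec (Pi.single j x) (Sum.inr i) = if i = j then star x else 0 := fun j i x => by
    simp only [boldVec, Sum.elim_inr, Pi.single_apply]
    split_ifs <;> simp
  have s1 : ∀ (j : Fin n) (x : ℂ), ∑ c, boldVec (Pi.single j x) c * a c
      = x * a (Sum.inl j) + star x * a (Sum.inr j) := fun j x => by
    simp only [Fintype.sum_sum_type, b1, b2, ite_mul, zero_mul, Finset.sum_ite_eq',
      Finset.mem_univ, if_true]
  have s2 : ∀ (j : Fin n) (x : ℂ), sympl (boldVec z) (boldVec (Pi.single j x))
      = z j * star x - star (z j) * x := fun j x => by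
    simp only [sympl, b1, b2, mul_ite, mul_zero, Finset.sum_sub_distrib, Finset.sum_ite_eq',
      Finset.mem_univ, if_true]
    rfl
  -- The derivative splits into its complex linear and antilinear parts in the j-th direction. The
  -- commutator contributes b z̄_j/2 and −b z_j/2 respectively, and the J-term cancels these after
  -- division by i.
  rcases c with j | j
  · have e : (Matrix.J (Fin n) ℂ).mulVec (Complex.I • boldVec z) (Sum.inl j)
        = -(Complex.I * starRingEnd ℂ (z j)) := by
      simp [Matrix.J, Matrix.fromBlocks_mulVec, boldVec, Matrix.neg_mulVec]
    simp only [wirtinger, h.fderiv, formDeriv_apply, s1, s2, e, Complex.inv_I, star_one,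
      Complex.star_def, Complex.conj_I]
    linear_combination (-a (Sum.inl j) + Complex.I * b * (z j + starRingEnd ℂ (z j)) / 4
      + Complex.I ^ 2 * (a (Sum.inl j) - a (Sum.inr j)) / 2) * Complex.I_sq
  · have e : (Matrix.J (Fin n) ℂ).mulVec (Complex.I • boldVec z) (Sum.inr j)
        = Complex.I * z j := by
      simp [Matrix.J, Matrix.fromBlocks_mulVec, boldVec]
    simp only [wirtinger, h.fderiv, formDeriv_apply, s1, s2, e, Complex.inv_I, star_one,
      Complex.star_def, Complex.conj_I]
    linear_combination (-a (Sum.inr j) - Complex.I * b * (z j + starRingEnd ℂ (z j)) / 4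
      - Complex.I ^ 2 * (a (Sum.inl j) - a (Sum.inr j)) / 2) * Complex.I_sq

/-- Componentwise the operator removes the commutator part of the derivative and keeps the moment
with one more basic form; linearity in the last form gives general g. Appending on the right is why
the operator of the first form acts first. -/
theorem diffOp_weylMoment (hρ : IsDensity ρ) (hm : HasMoments ρ m)
    {gs : List (Fin n ⊕ Fin n → ℂ)} (hgs : gs.length < m) (g : Fin n ⊕ Fin n → ℂ) :
    diffOp g (weylMoment ρ gs) = weylMoment ρ (gs ++ [g]) := by
  funext z
  rw [weylMoment_concat hρ hm hgs, diffOp]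
  refine Finset.sum_congr rfl fun c _ => ?_
  rw [wirtinger_of_hasFDerivAt (hasFDerivAt_weylMoment hρ hm hgs z) c]

theorem iterDiffOp_weylMoment (hρ : IsDensity ρ) (hm : HasMoments ρ m)
    (gs hs : List (Fin n ⊕ Fin n → ℂ)) (h : gs.length + hs.length ≤ m) :
    iterDiffOp hs (weylMoment ρ gs) = weylMoment ρ (gs ++ hs) := by
  induction hs generalizing gs with
  | nil => simp [iterDiffOp]
  | cons g hs ih =>
    rw [List.length_cons] at h
    rw [iterDiffOp, List.foldl_cons, diffOp_weylMoment hρ hm (by omega), ← iterDiffOp,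
      ih _ (by simp; omega), List.append_assoc]
    rfl

/-! ### Evaluation at zero and the characteristic function -/

theorem weyl_zero (u : Fock n) : weyl 0 u = u := by
  have hb : ∀ l : Fin n → ℕ, weyl 0 (fockBasis l) = fockBasis l := by
    intro l
    have hX : linForm (boldVec (0 : Fin n → ℂ)) = 0 := by
      have : boldVec (0 : Fin n → ℂ) = 0 := by
        funext c
        rcases c with j | j <;> simp [boldVec]
      simp [linForm, this]
    refine (weyl_fockBasis 0 l).unique ?_
    have h0 : expTerm 0 l 0 = fockBasis l := by
      rw [expTerm]
      simp
      rfl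
    rw [← h0]
    refine hasSum_single 0 fun r hr => ?_
    have : powVec (boldVec (0 : Fin n → ℂ)) l r = 0 := by
      apply lp.ext
      change (linForm _ ^ r) _ = _
      rw [hX, zero_pow hr]
      rfl
    rw [expTerm, this, smul_zero]
  have h := (hasSum_fockBasis u).mapL (weyl 0)
  simp only [map_smul, hb] at h
  exact h.unique (hasSum_fockBasis u)

theorem charEntry_eq (z : Fin n → ℂ) (k : Fin n → ℕ) :
    charEntry ρ z k = linProd [] (weyl z (ρ (fockBasis k)) : FockSeq n) k := by
  rw [charEntry, inner_fockBasis, linProd_nil]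

theorem charFunction_eq : charFunction ρ = weylMoment ρ [] :=
  funext fun z => tsum_congr (charEntry_eq z)

end

end
theorem corollary1 {n : ℕ} (ρ : Fock n →L[ℂ] Fock n) (hρ : IsDensity ρ)
    (m : ℕ) (hm : HasMoments ρ m) (g : Fin m → (Fin n ⊕ Fin n → ℂ)) :
    (∀ z, Summable (charEntry ρ z)) ∧
    ContDiff ℝ m (charFunction ρ) ∧
    HasSum (diagEntry ((List.ofFn fun k => linForm (g k)).prod) ρ)
      (iterDiffOp (List.ofFn g) (charFunction ρ) 0) := by
  refine ⟨fun z => ?_, ?_, ?_⟩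
  · rw [funext (charEntry_eq z)]
    exact summable_linProd_weyl hρ hm (by simp) z
  · rw [charFunction_eq]
    exact contDiff_weylMoment hρ hm m (by simp)
  · rw [charFunction_eq, iterDiffOp_weylMoment hρ hm [] (List.ofFn g) (by simp), List.nil_append]
    have h := (summable_linProd_weyl hρ hm (gs := List.ofFn g) (by simp) 0).hasSum
    have e : (List.ofFn fun k => linForm (g k)).prod = linProd (List.ofFn g) := by
      rw [linProd, List.map_ofFn]
      rfl
    rw [e]
    -- At z = 0 the Weyl operator is the identity, so the summands of the Weyl moment are the
    -- diagonal entries for the bare product.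
    have e2 : diagEntry (linProd (List.ofFn g)) ρ
        = fun k => linProd (List.ofFn g) (weyl 0 (ρ (fockBasis k)) : FockSeq n) k :=
      funext fun k => by rw [weyl_zero]; rfl
    rw [e2]
    exact h
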